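/- **Definitions.** Write $\Delta f(z)=f(z+1)-f(z)$ and $z^{\underline n}=z(z-1)\cdots(z-n+1)$. A point $z_0$ is a zero of an entire function $f$ with length $n\ge 1$ if $\Delta^kf(z_0)=0$ for $0\le k<n$ and $\Delta^nf(z_0)\ne0$. Entire functions $f,g$ have a common shifting divisor if there are a zero $z_1$ of $f$ with length $m$, a zero $z_2$ of $g$ with length $n$, integers $1\le m_1\le m$, $1\le n_1\le n$, a point $z_0\in\{z_1,z_2\}$ and entire functions $F,G$ such that $f(z)=(z-z_1)^{\underline{m_1}}F(z)$, $g(z)=(z-z_2)^{\underline{n_1}}G(z)$ and $f(z)g(z)=(z-z_0)^{\underline{m_1+n_1}}F(z)G(z)$; otherwise $f$ and $g$ are relatively shifting prime. For an entire function $f\not\equiv0$ and $r\ge0$, split off successively from $f$ factors $(z-z_j)^{\underline{n_j}}$, where at each step $z_j,z_j+1,\dots,z_j+n_j-1$ ($n_j\ge1$) lie in $\overline D(0,r)$ and are zeros of the remaining function, while each of the points $z_j-1$ and $z_j+n_j$ either lies outside $\overline D(0,r)$ or is not a zero of the remaining function, until a function without zeros in $\overline D(0,r)$ is left. The points $z_j$,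 counted with repetitions, are the initial shifting zeros of $f$ in $\overline D(0,r)$ (they do not depend on the choices made); their number is $\overline n_\Delta(r,1/f)$, and $$\overline N_\Delta\left(r,\tfrac1f\right)=\int_0^r\frac{\overline n_\Delta(t,1/f)-\overline n_\Delta(0,1/f)}{t}\,dt+\overline n_\Delta\left(0,\tfrac1f\right)\log r .$$ The order of $f$ is $\rho(f)=\limsup_{r\to\infty}\log^+T(r,f)/\log r$, with $T(r,f)$ the Nevanlinna characteristic. For entire functions $a,b,c\not\equiv0$ put $u=\max\{|a|,|b|,|c|\}$ and $$\widetilde T_{a,b,c}(r)=\frac1{2\pi}\int_0^{2\pi}\log u(re^{i\theta})\,d\theta-\kappa,$$ where $\kappa=\log u(0)$ if $u(0)\neq0$, and otherwise $\kappa$ is the maximum of $\log|\alpha|,\log|\beta|,\log|\gamma|$, with $\alpha,\beta,\gamma$ the first non-zero Taylor coefficients of $a,b,c$ at $0$. A measurable set $E\subset(1,\infty)$ has finite logarithmic measure if $\int_E dt/t<\infty$. **Theorem.** Let $a,b,c$ be entire functions, none of them identically zero, of order less than $1$, pairwise relatively shifting prime, not all constant, with $a+b=c$, and let $\delta=\max\{\rho(a),\rho(b),\rho(c)\}$.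 Then there exists $R>0$ such that for every $\varepsilon>0$ $$\widetilde T_{a,b,c}(r)\le\overline N_\Delta\left(r,\tfrac1{abc}\right)-(1-\delta-\varepsilon)\log r=\overline N_\Delta\left(r,\tfrac1a\right)+\overline N_\Delta\left(r,\tfrac1b\right)+\overline N_\Delta\left(r,\tfrac1c\right)-(1-\delta-\varepsilon)\log r$$ holds for all $r>R$ outside an exceptional set, which may depend on $\varepsilon$, of finite logarithmic measure. -/

import Mathlib

namespace DiffABC

open Set Filter

/-- The falling factorial `z (z - 1) ⋯ (z - n + 1)`. -/
noncomputable def fallingFactorial (n : ℕ) (z : ℂ) : ℂ :=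
  (descPochhammer ℂ n).eval z

/-- `z₀` is a zero of `f` with length `n ≥ 1` (in the whole plane): the iterated differences
`Δ^k f (z₀)`, where `Δ f (z) = f (z + 1) - f (z)`, vanish for `k < n`, and `Δ^n f (z₀) ≠ 0`. -/
def IsZeroOfLength (f : ℂ → ℂ) (z₀ : ℂ) (n : ℕ) : Prop :=
  1 ≤ n ∧ (∀ k < n, (fwdDiff (1 : ℂ))^[k] f z₀ = 0) ∧ (fwdDiff (1 : ℂ))^[n] f z₀ ≠ 0

/-- The entire functions `f` and `g` have a common shifting divisor `z - z₀`. -/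
def HasCommonShiftingDivisor (f g : ℂ → ℂ) : Prop :=
  ∃ (z₁ z₂ z₀ : ℂ) (m n m₁ n₁ : ℕ) (F G : ℂ → ℂ),
    IsZeroOfLength f z₁ m ∧ IsZeroOfLength g z₂ n ∧
    1 ≤ m₁ ∧ m₁ ≤ m ∧ 1 ≤ n₁ ∧ n₁ ≤ n ∧
    Differentiable ℂ F ∧ Differentiable ℂ G ∧
    (∀ z, f z = fallingFactorial m₁ (z - z₁) * F z) ∧
    (∀ z, g z = fallingFactorial n₁ (z - z₂) * G z) ∧
    (z₀ = z₁ ∨ z₀ = z₂) ∧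
    ∀ z, f z * g z = fallingFactorial (m₁ + n₁) (z - z₀) * (F z * G z)

/-- `f` and `g` are relatively shifting prime. -/
def RelativelyShiftingPrime (f g : ℂ → ℂ) : Prop :=
  ¬ HasCommonShiftingDivisor f g

/-- `z` is the first point, and `n` the length, of a maximal run `z, z + 1, …, z + n - 1` of zeros
of `f` in the closed disc of radius `r` about `0`: the run lies in the disc, it cannot be extended
to the right inside the disc, and `z - 1` is not a zero of `f` in the disc. -/
structure IsInitialZeroInDisc (r : ℝ) (f : ℂ → ℂ) (z : ℂ) (n : ℕ) : Prop where
  pos : 1 ≤ n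
  mem : ∀ j < n, z + (j : ℂ) ∈ Metric.closedBall (0 : ℂ) r
  zero : ∀ k < n, (fwdDiff (1 : ℂ))^[k] f z = 0
  right : z + (n : ℂ) ∈ Metric.closedBall (0 : ℂ) r → (fwdDiff (1 : ℂ))^[n] f z ≠ 0
  left : z - 1 ∈ Metric.closedBall (0 : ℂ) r → f (z - 1) ≠ 0

/-- `ShiftFactorization r f s`: successively splitting off factors `(z - z_j)^{\underline{n_j}}`
belonging to maximal runs of zeros in the closed disc of radius `r`, one arrives at a function
without zeros in that disc; `s` is the multiset of the points `z_j`. -/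
inductive ShiftFactorization (r : ℝ) : (ℂ → ℂ) → Multiset ℂ → Prop
  | nil {F : ℂ → ℂ} (h : ∀ z ∈ Metric.closedBall (0 : ℂ) r, F z ≠ 0) :
      ShiftFactorization r F 0
  | cons {f f₁ : ℂ → ℂ} {z : ℂ} {n : ℕ} {s : Multiset ℂ}
      (hz : IsInitialZeroInDisc r f z n) (hd : Differentiable ℂ f₁)
      (hf : ∀ w, f w = fallingFactorial n (w - z) * f₁ w)
      (hs : ShiftFactorization r f₁ s) : ShiftFactorization r f (z ::ₘ s)

open Classical in
/-- The multiset of initial shifting zeros of `f` in the closed disc of radius `r` about `0`.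
It exists and is unique for every entire `f ≢ 0`, see `initialShiftingZeros_unique` and
`initialShiftingZeros_spec` below. -/
noncomputable def initialShiftingZeros (r : ℝ) (f : ℂ → ℂ) : Multiset ℂ :=
  if h : ∃ s, ShiftFactorization r f s then h.choose else 0

/-- The number of initial shifting zeros of `f` in the closed disc of radius `r`. -/
noncomputable def nBarDelta (r : ℝ) (f : ℂ → ℂ) : ℕ :=
  (initialShiftingZeros r f).card

/-- The integrated counting function of the initial shifting zeros of `f`. -/
noncomputable def NBarDelta (r : ℝ) (f : ℂ → ℂ) : ℝ :=
  (∫ t in (0 : ℝ)..r, ((nBarDelta t f : ℝ) - (nBarDelta 0 f : ℝ)) / t)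
    + (nBarDelta 0 f : ℝ) * Real.log r

/-- The order of growth `limsup_{r → ∞} log⁺ T(r, f) / log r`, with `T` the Nevanlinna
characteristic. -/
noncomputable def growthOrder (f : ℂ → ℂ) : EReal :=
  limsup (fun r : ℝ =>
    ((Real.posLog (ValueDistribution.characteristic f ⊤ r) / Real.log r : ℝ) : EReal)) atTop

/-- `u(z) = max {|a(z)|, |b(z)|, |c(z)|}`. -/
noncomputable def maxNorm (a b c : ℂ → ℂ) (z : ℂ) : ℝ :=
  max (max ‖a z‖ ‖b z‖) ‖c z‖

/-- The Cartan type characteristic of three entire functions `≢ 0`, which may have common zeros.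
If all of them vanish at `0`, the normalisation uses the leading Taylor coefficients at `0`. -/
noncomputable def cartanChar (a b c : ℂ → ℂ) (r : ℝ) : ℝ :=
  Real.circleAverage (fun z => Real.log (maxNorm a b c z)) 0 r -
    if maxNorm a b c 0 ≠ 0 then Real.log (maxNorm a b c 0)
    else max (max (Real.log ‖meromorphicTrailingCoeffAt a 0‖)
      (Real.log ‖meromorphicTrailingCoeffAt b 0‖)) (Real.log ‖meromorphicTrailingCoeffAt c 0‖)

/-- `E ⊆ (1, ∞)` has finite logarithmic measure `∫_E dt / t < ∞`. -/
def FiniteLogMeasure (E : Set ℝ) : Prop :=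
  E ⊆ Ioi 1 ∧ MeasurableSet E ∧ ∫⁻ t in E, ENNReal.ofReal t⁻¹ < ⊤

/-! The multiset of initial shifting zeros is well defined. -/

theorem fallingFactorial_succ (n : ℕ) (z : ℂ) :
    fallingFactorial (n + 1) z = fallingFactorial n z * (z - n) := by
  simp [fallingFactorial, descPochhammer_succ_eval]

theorem fallingFactorial_ne_zero (n : ℕ) : fallingFactorial n (n : ℂ) ≠ 0 := by
  unfold fallingFactorial
  rw [descPochhammer_eval_eq_descFactorial, Nat.descFactorial_self]
  exact_mod_cast n.factorial_ne_zero

theorem differentiable_fallingFactorial (n : ℕ) (z : ℂ) :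
    Differentiable ℂ (fun w => fallingFactorial n (w - z)) := by
  unfold fallingFactorial
  exact (descPochhammer ℂ n).differentiable.comp (differentiable_id.sub_const z)

theorem iter_fwdDiff_of_vanish {f : ℂ → ℂ} {z : ℂ} {n : ℕ} (h : ∀ j < n, f (z + j) = 0) :
    (fwdDiff (1 : ℂ))^[n] f z = f (z + n) := by
  rw [fwdDiff_iter_eq_sum_shift, Finset.sum_range_succ, Finset.sum_eq_zero]
  · simp
  · intro k hk
    simp [h k (Finset.mem_range.1 hk)]

theorem iter_fwdDiff_vanish_iff {f : ℂ → ℂ} {z : ℂ} {n : ℕ} :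
    (∀ k < n, (fwdDiff (1 : ℂ))^[k] f z = 0) ↔ ∀ j < n, f (z + j) = 0 := by
  induction n with
  | zero => simp
  | succ n ih =>
    rw [Nat.forall_lt_succ_right, Nat.forall_lt_succ_right, ih]
    refine and_congr_right fun h => ?_
    rw [iter_fwdDiff_of_vanish h]

open Classical in
theorem order_sub_const (c w : ℂ) :
    analyticOrderAt (fun x : ℂ => x - c) w = if w = c then 1 else 0 := by
  split_ifs with h
  · subst h; exact analyticOrderAt_id_sub_const_self
  · exact analyticOrderAt_id_sub_const_of_ne h

open Classical in
theorem order_fallingFactorial (n : ℕ) (z w : ℂ) :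
    analyticOrderAt (fun x => fallingFactorial n (x - z)) w
      = if ∃ j < n, w = z + (j : ℂ) then 1 else 0 := by
  induction n with
  | zero =>
    have : (fun x : ℂ => fallingFactorial 0 (x - z)) = fun _ => 1 := by
      funext x; simp [fallingFactorial]
    rw [this]
    simp [analyticOrderAt_eq_zero]
  | succ n ih =>
    have : (fun x : ℂ => fallingFactorial (n + 1) (x - z))
        = (fun x => fallingFactorial n (x - z)) * fun x => x - (z + n) := by
      funext x; simp [fallingFactorial_succ, sub_sub]
    rw [this, analyticOrderAt_mul ((differentiable_fallingFactorial n z).analyticAt w)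
      ((differentiable_fun_id.sub_const (z + (n : ℂ))).analyticAt w), ih, order_sub_const]
    by_cases h : ∃ j < n, w = z + (j : ℂ)
    · have h2 : ¬ w = z + n := by
        obtain ⟨j, hj, rfl⟩ := h
        intro h
        have : (j : ℂ) = n := by simpa using h
        exact hj.ne (by exact_mod_cast this)
      have h3 : ∃ j < n + 1, w = z + (j : ℂ) := by
        obtain ⟨j, hj, e⟩ := h
        exact ⟨j, by omega, e⟩
      rw [if_pos h, if_neg h2, if_pos h3, add_zero]
    · by_cases h2 : w = z + n
      · rw [if_neg h, if_pos h2, if_pos ⟨n, by omega, h2⟩, zero_add]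
      · have h3 : ¬ ∃ j < n + 1, w = z + (j : ℂ) := by
          rintro ⟨j, hj, e⟩
          rcases Nat.lt_succ_iff_lt_or_eq.1 hj with hj | rfl
          · exact h ⟨j, hj, e⟩
          · exact h2 e
        rw [if_neg h, if_neg h2, if_neg h3, add_zero]

theorem order_ne_top {f : ℂ → ℂ} (hf : Differentiable ℂ f) (h0 : f ≠ 0) (w : ℂ) :
    analyticOrderAt f w ≠ ⊤ := by
  intro h
  rw [analyticOrderAt_eq_top] at h
  apply h0
  have := (hf.differentiableOn.analyticOnNhd isOpen_univ).eqOn_zero_of_preconnected_of_eventuallyEq_zero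
    isPreconnected_univ (mem_univ w) h
  funext x
  exact this (mem_univ x)

theorem orderNat_eq_zero_iff {f : ℂ → ℂ} (hf : Differentiable ℂ f) (h0 : f ≠ 0) (w : ℂ) :
    analyticOrderNatAt f w = 0 ↔ f w ≠ 0 := by
  rw [← (hf.analyticAt w).analyticOrderAt_eq_zero,
    ← Nat.cast_analyticOrderNatAt (order_ne_top hf h0 w)]
  simp

open Classical in
theorem orderNat_factor {f f₁ : ℂ → ℂ} {z : ℂ} {n : ℕ} (h0 : f ≠ 0)
    (hd : Differentiable ℂ f₁) (hf : ∀ w, f w = fallingFactorial n (w - z) * f₁ w) (w : ℂ) :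
    analyticOrderNatAt f w
      = (if ∃ j < n, w = z + (j : ℂ) then 1 else 0) + analyticOrderNatAt f₁ w := by
  have e : f = (fun x => fallingFactorial n (x - z)) * f₁ := funext hf
  have h1 : f₁ ≠ 0 := by
    rintro rfl
    exact h0 (by funext x; simp [hf x])
  have hP := order_fallingFactorial n z w
  rw [e, analyticOrderNatAt_mul ((differentiable_fallingFactorial n z).analyticAt w)
    (hd.analyticAt w) (by rw [hP]; split_ifs <;> simp) (order_ne_top hd h1 w)]
  congr 1
  unfold analyticOrderNatAt
  rw [hP]
  split_ifs <;> simp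

open Classical in
/-- The multiplicity of `w` as an initial shifting zero of `f`, in terms of the orders of the zeros
of `f` at `w` and `w - 1`. -/
theorem ShiftFactorization.count_eq {r : ℝ} {f : ℂ → ℂ} {s : Multiset ℂ}
    (h : ShiftFactorization r f s) (hf : Differentiable ℂ f) (h0 : f ≠ 0) (w : ℂ) :
    s.count w = if w ∈ Metric.closedBall (0 : ℂ) r then
      analyticOrderNatAt f w -
        (if w - 1 ∈ Metric.closedBall (0 : ℂ) r then analyticOrderNatAt f (w - 1) else 0)
      else 0 := by
  induction h with
  | @nil F h =>
    split_ifs with h1 h2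
    · simp [(orderNat_eq_zero_iff hf h0 w).2 (h w h1)]
    · simp [(orderNat_eq_zero_iff hf h0 w).2 (h w h1)]
    · simp
  | @cons f f₁ z n s hz hd hfac hs ih =>
    have h1 : f₁ ≠ 0 := by
      rintro rfl
      exact h0 (by funext x; simp [hfac x])
    have IH := ih hd h1
    have ow := orderNat_factor h0 hd hfac w
    have ow1 := orderNat_factor h0 hd hfac (w - 1)
    have hzero := iter_fwdDiff_vanish_iff.1 hz.zero
    rw [Multiset.count_cons, IH]
    by_cases hw : w ∈ Metric.closedBall (0 : ℂ) r
    swap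
    · have : w ≠ z := by
        rintro rfl
        exact hw (by simpa using hz.mem 0 hz.pos)
      simp [hw, this]
    rw [if_pos hw, if_pos hw]
    by_cases hwz : w = z
    · subst hwz
      rw [if_pos rfl]
      rw [if_pos ⟨0, hz.pos, by simp⟩] at ow
      split_ifs with h2
      · have := (orderNat_eq_zero_iff hf h0 _).2 (hz.left h2)
        omega
      · omega
    rw [if_neg hwz]
    by_cases hw1 : ∃ j < n, w = z + (j : ℂ)
    · rw [if_pos hw1] at ow
      obtain ⟨j, hj, hj'⟩ := hw1
      obtain _ | j := j
      · exact absurd (by simpa using hj') hwz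
      have e : w - 1 = z + (j : ℂ) := by rw [hj']; push_cast; ring
      rw [if_pos ⟨j, by omega, e⟩] at ow1
      have : w - 1 ∈ Metric.closedBall (0 : ℂ) r := by rw [e]; exact hz.mem j (by omega)
      rw [if_pos this, if_pos this]
      omega
    rw [if_neg hw1] at ow
    by_cases hw2 : ∃ j < n, w - 1 = z + (j : ℂ)
    · obtain ⟨j, hj, hj'⟩ := hw2
      have e : w = z + ((j + 1 : ℕ) : ℂ) := by
        push_cast
        rw [← add_assoc, ← hj']; ring
      have hn : j + 1 = n := by
        by_contra hne
        exact hw1 ⟨j + 1, by omega, e⟩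
      rw [hn] at e
      have hne : f w ≠ 0 := by
        have := hz.right (e ▸ hw)
        rwa [iter_fwdDiff_of_vanish hzero, ← e] at this
      have := (orderNat_eq_zero_iff hf h0 _).2 hne
      omega
    rw [if_neg hw2] at ow1
    rw [ow, ow1]
    simp

theorem initialShiftingZeros_unique {r : ℝ} {f : ℂ → ℂ} (hf : Differentiable ℂ f) (h0 : f ≠ 0)
    {s t : Multiset ℂ} (hs : ShiftFactorization r f s) (ht : ShiftFactorization r f t) : s = t := by
  classical
  ext w
  rw [hs.count_eq hf h0, ht.count_eq hf h0]

theorem exists_factor {f : ℂ → ℂ} (hf : Differentiable ℂ f) {z : ℂ} {n : ℕ}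
    (h : ∀ j < n, f (z + j) = 0) :
    ∃ f₁, Differentiable ℂ f₁ ∧ ∀ w, f w = fallingFactorial n (w - z) * f₁ w := by
  induction n with
  | zero => exact ⟨f, hf, fun w => by simp [fallingFactorial]⟩
  | succ n ih =>
    obtain ⟨g, hg, hfg⟩ := ih fun j hj => h j (by omega)
    have hg0 : g (z + n) = 0 := by
      have := h n (by omega)
      rw [hfg, add_sub_cancel_left] at this
      exact (mul_eq_zero.1 this).resolve_left (fallingFactorial_ne_zero n)
    refine ⟨dslope g (z + n), ?_, fun w => ?_⟩
    · rw [← differentiableOn_univ] at hg ⊢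
      exact (Complex.differentiableOn_dslope Filter.univ_mem).2 hg
    · rw [hfg, fallingFactorial_succ, mul_assoc]
      congr 1
      have := sub_smul_dslope g (z + n) w
      rw [hg0, sub_zero, smul_eq_mul] at this
      rw [← this]
      ring

theorem exists_not_mem_disc (r : ℝ) (z e : ℂ) (he : ‖e‖ = 1) :
    ∃ m : ℕ, z + m * e ∉ Metric.closedBall (0 : ℂ) r := by
  obtain ⟨m, hm⟩ := exists_nat_gt (r + ‖z‖)
  refine ⟨m, fun h => ?_⟩
  rw [mem_closedBall_zero_iff] at h
  have h1 : ‖(m : ℂ) * e‖ = m := by simp [he]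
  have h2 := norm_sub_le (z + m * e) z
  rw [add_sub_cancel_left, h1] at h2
  linarith

theorem exists_initialZero {r : ℝ} {f : ℂ → ℂ} {w : ℂ}
    (hw : w ∈ Metric.closedBall (0 : ℂ) r) (hfw : f w = 0) :
    ∃ z n, IsInitialZeroInDisc r f z n := by
  classical
  have h1 : ∃ m : ℕ, ¬ (w + ((m + 1 : ℕ) : ℂ) * (-1) ∈ Metric.closedBall (0 : ℂ) r ∧
      f (w + ((m + 1 : ℕ) : ℂ) * (-1)) = 0) := by
    obtain ⟨m, hm⟩ := exists_not_mem_disc r w (-1) (by simp)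
    obtain _ | m := m
    · exact absurd hw (by simpa using hm)
    · exact ⟨m, fun h => hm h.1⟩
  obtain ⟨z, hz, hfz, hleft⟩ : ∃ z ∈ Metric.closedBall (0 : ℂ) r, f z = 0 ∧
      (z - 1 ∈ Metric.closedBall (0 : ℂ) r → f (z - 1) ≠ 0) := by
    have hspec := Nat.find_spec h1
    have hmin := fun k => @Nat.find_min _ _ h1 k
    generalize Nat.find h1 = m at hspec hmin
    have key : w + (m : ℂ) * (-1) ∈ Metric.closedBall (0 : ℂ) r ∧ f (w + (m : ℂ) * (-1)) = 0 := by
      obtain _ | m := m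
      · simpa using ⟨by simpa using hw, hfw⟩
      · exact not_not.1 (hmin m (by omega))
    refine ⟨_, key.1, key.2, fun h2 h3 => hspec ?_⟩
    have e : w + ((m + 1 : ℕ) : ℂ) * (-1) = w + (m : ℂ) * (-1) - 1 := by push_cast; ring
    rw [e]
    exact ⟨h2, h3⟩
  have h2 : ∃ n : ℕ, ¬ (z + (n : ℂ) ∈ Metric.closedBall (0 : ℂ) r ∧ f (z + n) = 0) := by
    obtain ⟨m, hm⟩ := exists_not_mem_disc r z 1 (by simp)
    exact ⟨m, fun h => hm (by simpa using h.1)⟩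
  have hspec := Nat.find_spec h2
  have hmin := fun k => @Nat.find_min _ _ h2 k
  generalize Nat.find h2 = n at hspec hmin
  have hzero : ∀ j < n, f (z + j) = 0 := fun j hj => (not_not.1 (hmin j hj)).2
  refine ⟨z, n, ?_, fun j hj => (not_not.1 (hmin j hj)).1, iter_fwdDiff_vanish_iff.2 hzero,
    fun h h' => hspec ⟨h, ?_⟩, hleft⟩
  · by_contra hn
    have : n = 0 := by omega
    subst this
    exact hspec (by simpa using ⟨by simpa using hz, hfz⟩)
  · rwa [iter_fwdDiff_of_vanish hzero] at h'

theorem exists_shiftFactorization_aux {r : ℝ} (S : Finset ℂ) (N : ℕ) :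
    ∀ f : ℂ → ℂ, Differentiable ℂ f → f ≠ 0 →
      (∀ w ∈ Metric.closedBall (0 : ℂ) r, f w = 0 → w ∈ S) →
      ∑ w ∈ S, analyticOrderNatAt f w = N → ∃ s, ShiftFactorization r f s := by
  classical
  induction N using Nat.strong_induction_on with
  | _ N ih =>
    intro f hf h0 hS hN
    by_cases hw : ∀ w ∈ Metric.closedBall (0 : ℂ) r, f w ≠ 0
    · exact ⟨0, .nil hw⟩
    push Not at hw
    obtain ⟨w, hw, hfw⟩ := hw
    obtain ⟨z, n, hz⟩ := exists_initialZero hw hfw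
    have hzero := iter_fwdDiff_vanish_iff.1 hz.zero
    obtain ⟨f₁, hd, hfac⟩ := exists_factor hf hzero
    have h1 : f₁ ≠ 0 := by
      rintro rfl
      exact h0 (by funext x; simp [hfac x])
    have hzS : z ∈ S := hS z (by simpa using hz.mem 0 hz.pos) (by simpa using hzero 0 hz.pos)
    have hlt : ∑ w ∈ S, analyticOrderNatAt f₁ w < N := by
      rw [← hN]
      refine Finset.sum_lt_sum (fun x _ => ?_) ⟨z, hzS, ?_⟩
      · rw [orderNat_factor h0 hd hfac x]; omega
      · rw [orderNat_factor h0 hd hfac z, if_pos ⟨0, hz.pos, by simp⟩]; omega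
    obtain ⟨s, hs⟩ := ih _ hlt f₁ hd h1
      (fun x hx hx0 => hS x hx (by rw [hfac, hx0, mul_zero])) rfl
    exact ⟨z ::ₘ s, .cons hz hd hfac hs⟩

theorem initialShiftingZeros_spec (r : ℝ) {f : ℂ → ℂ} (hf : Differentiable ℂ f) (h0 : f ≠ 0) :
    ShiftFactorization r f (initialShiftingZeros r f) := by
  have hfin : (Metric.closedBall (0 : ℂ) r ∩ f ⁻¹' {0}).Finite := by
    obtain ⟨x, hx⟩ : ∃ x, f x ≠ 0 := by
      by_contra! h
      exact h0 (funext h)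
    have h := AnalyticOnNhd.preimage_zero_mem_codiscrete
      (hf.differentiableOn.analyticOnNhd isOpen_univ) hx
    refine ((isCompact_closedBall (0 : ℂ) r).finite_sdiff_of_mem_codiscreteWithin
      (Filter.codiscreteWithin_mono (subset_univ _) h)).subset ?_
    rintro w ⟨hw, hw0⟩
    exact ⟨hw, fun h => h hw0⟩
  have h : ∃ s, ShiftFactorization r f s :=
    exists_shiftFactorization_aux hfin.toFinset _ f hf h0
      (fun w hw hw0 => by simpa using ⟨by simpa using hw, hw0⟩) rfl
  rw [initialShiftingZeros, dif_pos h]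
  exact h.choose_spec

end DiffABC

open DiffABC

namespace DiffABC

open Set Filter Metric Topology Real MeasureTheory
open scoped ENNReal

/-! The proof follows the Wronskian proof of the polynomial abc theorem, with the Casoratian W(z) =
a(z) b(z+1) - b(z) a(z+1) in place of the Wronskian. Since a + b = c, W is up to sign the Casoratian
of any two of a, b, c. Hence, if |Δf| ≤ B |f| at z for f = a, b, c, then u |W| ≤ 2B |abc| at z. For
order less than 1 and δ < γ < 1, B = 2 r^(γ-1) is admissible on |z| = r off a set of radii of finite
logarithmic measure (`exists_exceptional_set`). Averaging logarithms over the circle gives mean log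
u + mean log|W| ≤ mean log|abc| + (γ-1) log r + O(1).

Let m(w) be the multiplicity of w as a zero. The shifting count differs from the full count of zeros
by min(m(w), m(w-1)) for each w such that w and w-1 both lie in the disc. Primality forbids a zero
of one function followed by a zero of another, so for abc this minimum comes from a single f among
a, b, c. As W is a combination of f(z) and f(z+1), the minimum is at most the multiplicity of W at
w-1. By Jensen's formula the total loss is at most the counting function of W (`le_NBarDelta_add`),
and mean log|W| cancels. The same fact about minima makes the counting functions additive
(`NBarDelta_mul_mul`).

If W vanishes identically, b and c are constant multiples of a (`casoratian_eq_zero_proportional`).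
Then no zero of a is followed by another, every zero is counted fully for each of a, b, c, and the
surplus 2 N(r, 1/a) ≥ 2 log r - O(1) suffices.

The difference quotient estimate rests on the product formula f(z+1)/f(z) = lim ∏ (1 + 1/(z-w))^m(w)
(`tendsto_prod_zeroFinset`) and on the convergence of ∑ m(w) |w|^(-σ) for σ above the order
(`tsum_order_mul_rpow_lt_top`). -/

/-! ### Zeros of entire functions and splitting them off -/

theorem finite_zeros_inter_closedBall {f : ℂ → ℂ} (hf : Differentiable ℂ f) (h0 : f ≠ 0) (r : ℝ) :
    (closedBall (0 : ℂ) r ∩ f ⁻¹' {0}).Finite := by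
  obtain ⟨x, hx⟩ : ∃ x, f x ≠ 0 := by
    by_contra! h
    exact h0 (funext h)
  have h := AnalyticOnNhd.preimage_zero_mem_codiscrete
    (hf.differentiableOn.analyticOnNhd isOpen_univ) hx
  refine ((isCompact_closedBall (0 : ℂ) r).finite_sdiff_of_mem_codiscreteWithin
    (Filter.codiscreteWithin_mono (subset_univ _) h)).subset ?_
  rintro w ⟨hw, hw0⟩
  exact ⟨hw, fun h => h hw0⟩

open Classical in
/-- The zeros of `f` in the closed disc of radius `r`, as a finset (empty if they are infinitely
many). -/
noncomputable def zeroFinset (f : ℂ → ℂ) (r : ℝ) : Finset ℂ :=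
  if h : (closedBall (0 : ℂ) r ∩ f ⁻¹' {0}).Finite then h.toFinset else ∅

theorem mem_zeroFinset {f : ℂ → ℂ} (hf : Differentiable ℂ f) (h0 : f ≠ 0) {r : ℝ} {w : ℂ} :
    w ∈ zeroFinset f r ↔ ‖w‖ ≤ r ∧ f w = 0 := by
  rw [zeroFinset, dif_pos (finite_zeros_inter_closedBall hf h0 r)]
  simp

theorem countable_zeros {f : ℂ → ℂ} (hf : Differentiable ℂ f) (h0 : f ≠ 0) :
    {w | f w = 0}.Countable := by
  have : {w | f w = 0} ⊆ ⋃ n : ℕ, closedBall (0 : ℂ) n ∩ f ⁻¹' {0} := by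
    intro w hw
    obtain ⟨n, hn⟩ := exists_nat_ge ‖w‖
    exact mem_iUnion.2 ⟨n, by simpa using hn, hw⟩
  exact (countable_iUnion fun n : ℕ =>
    (finite_zeros_inter_closedBall hf h0 (n : ℝ)).countable).mono this

theorem orderNat_pos {f : ℂ → ℂ} (hf : Differentiable ℂ f) (h0 : f ≠ 0) {w : ℂ} (hw : f w = 0) :
    0 < analyticOrderNatAt f w :=
  Nat.pos_of_ne_zero fun h => (orderNat_eq_zero_iff hf h0 w).1 h hw

theorem exists_eq_pow_orderNat_mul (w : ℂ) (n : ℕ) : ∀ {f : ℂ → ℂ}, Differentiable ℂ f → f ≠ 0 →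
    analyticOrderNatAt f w = n →
    ∃ g, Differentiable ℂ g ∧ (∀ z, f z = (z - w) ^ n * g z) ∧ g w ≠ 0 := by
  induction n with
  | zero =>
    intro f hf h0 hn
    exact ⟨f, hf, fun z => by simp, (orderNat_eq_zero_iff hf h0 w).1 hn⟩
  | succ n ih =>
    intro f hf h0 hn
    have hw : f w = 0 := by
      by_contra h
      rw [(orderNat_eq_zero_iff hf h0 w).2 h] at hn
      omega
    obtain ⟨f₁, hf₁, hfac⟩ := exists_factor (n := 1) hf (z := w) (by simpa using hw)
    have h1 : f₁ ≠ 0 := by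
      rintro rfl
      exact h0 (by funext x; simp [hfac x])
    have ho := orderNat_factor h0 hf₁ hfac w
    rw [if_pos ⟨0, by omega, by simp⟩] at ho
    obtain ⟨g, hg, hfg, hgw⟩ := ih hf₁ h1 (by omega)
    refine ⟨g, hg, fun z => ?_, hgw⟩
    rw [hfac, hfg, fallingFactorial_succ]
    simp only [fallingFactorial, descPochhammer_zero, Polynomial.eval_one]
    push_cast
    ring

theorem orderNat_mul {f g : ℂ → ℂ} (hf : Differentiable ℂ f) (hg : Differentiable ℂ g)
    (hf0 : f ≠ 0) (hg0 : g ≠ 0) (w : ℂ) :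
    analyticOrderNatAt (f * g) w = analyticOrderNatAt f w + analyticOrderNatAt g w :=
  analyticOrderNatAt_mul (hf.analyticAt w) (hg.analyticAt w) (order_ne_top hf hf0 w)
    (order_ne_top hg hg0 w)

theorem entire_mul_ne_zero {f g : ℂ → ℂ} (hf : Differentiable ℂ f) (hg : Differentiable ℂ g)
    (hf0 : f ≠ 0) (hg0 : g ≠ 0) : f * g ≠ 0 := by
  intro h
  have h1 := analyticOrderAt_mul (hf.analyticAt 0) (hg.analyticAt 0)
  rw [h] at h1
  have h2 : analyticOrderAt (0 : ℂ → ℂ) 0 = ⊤ := by simp [analyticOrderAt_eq_top]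
  rw [h2] at h1
  rcases WithTop.add_eq_top.1 h1.symm with h | h
  · exact order_ne_top hf hf0 0 h
  · exact order_ne_top hg hg0 0 h

theorem exists_eq_prod_mul {f : ℂ → ℂ} (hf : Differentiable ℂ f) (h0 : f ≠ 0) (S : Finset ℂ) :
    ∃ g, Differentiable ℂ g ∧ (∀ z, f z = (∏ w ∈ S, (z - w) ^ analyticOrderNatAt f w) * g z) ∧
      ∀ w ∈ S, g w ≠ 0 := by
  classical
  induction S using Finset.induction_on with
  | empty => exact ⟨f, hf, by simp, by simp⟩
  | insert w S hw ih =>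
    obtain ⟨g, hg, hfg, hgS⟩ := ih
    have hg0 : g ≠ 0 := by
      rintro rfl
      exact h0 (by funext x; simp [hfg x])
    have ho : analyticOrderNatAt g w = analyticOrderNatAt f w := by
      set P : ℂ → ℂ := fun z => ∏ w ∈ S, (z - w) ^ analyticOrderNatAt f w
      have hP : Differentiable ℂ P := by fun_prop
      have hPw : P w ≠ 0 := by
        refine Finset.prod_ne_zero_iff.2 fun v hv => pow_ne_zero _ (sub_ne_zero.2 ?_)
        rintro rfl
        exact hw hv
      have hP0 : P ≠ 0 := by
        intro h
        exact hPw (by rw [h]; rfl)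
      have e : f = P * g := funext hfg
      have := orderNat_mul hP hg hP0 hg0 w
      rw [← e, (orderNat_eq_zero_iff hP hP0 w).2 hPw, zero_add] at this
      exact this.symm
    obtain ⟨k, hk, hgk, hkw⟩ := exists_eq_pow_orderNat_mul w _ hg hg0 ho
    refine ⟨k, hk, fun z => ?_, ?_⟩
    · rw [hfg, hgk, Finset.prod_insert hw]
      ring
    · intro v hv
      rcases Finset.mem_insert.1 hv with rfl | hv
      · exact hkw
      · intro h
        exact hgS v hv (by rw [hgk, h, mul_zero])

/-- A factorization splitting off all zeros in the closed disc of radius `r`. -/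
theorem exists_eq_prod_zeroFinset_mul {f : ℂ → ℂ} (hf : Differentiable ℂ f) (h0 : f ≠ 0) (r : ℝ) :
    ∃ g, Differentiable ℂ g ∧
      (∀ z, f z = (∏ w ∈ zeroFinset f r, (z - w) ^ analyticOrderNatAt f w) * g z) ∧
      ∀ z, ‖z‖ ≤ r → g z ≠ 0 := by
  obtain ⟨g, hg, hfg, hgS⟩ := exists_eq_prod_mul hf h0 (zeroFinset f r)
  refine ⟨g, hg, hfg, fun z hz h => ?_⟩
  exact hgS z ((mem_zeroFinset hf h0).2 ⟨hz, by rw [hfg, h, mul_zero]⟩) h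

/-! ### Pointwise bounds from the characteristic -/

/-- Poisson's formula for the harmonic function log|g|: for |w| ≤ R/2 the kernel lies between 0 and
(R + |w|)/(R - |w|) ≤ 3. -/
theorem log_norm_le_circleAverage_of_ne_zero {g : ℂ → ℂ} (hg : Differentiable ℂ g) {R : ℝ}
    (hR : 0 < R) (h : ∀ z, ‖z‖ ≤ R → g z ≠ 0) {w : ℂ} (hw : ‖w‖ ≤ R / 2) :
    Real.log ‖g w‖ ≤ 3 * circleAverage (fun z => Real.posLog ‖g z‖) 0 R := by
  have hharm : InnerProductSpace.HarmonicOnNhd (fun z => Real.log ‖g z‖) (closedBall 0 R) :=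
    fun z hz => (hg.analyticAt z).harmonicAt_log_norm (h z (by simpa using hz))
  have hwb : w ∈ ball (0 : ℂ) R := by
    rw [mem_ball_zero_iff]; linarith
  have hP := hharm.circleAverage_re_herglotzRieszKernel_smul hwb
  have hcont : ContinuousOn (fun z => Real.log ‖g z‖) (sphere 0 |R|) := by
    refine ContinuousOn.log hg.continuous.norm.continuousOn fun z hz => ?_
    rw [abs_of_pos hR, mem_sphere_zero_iff_norm] at hz
    exact norm_ne_zero_iff.2 (h z hz.le)
  rw [← hP, ← smul_eq_mul, ← circleAverage_fun_smul]
  refine circleAverage_mono ?_ ?_ ?_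
  · refine ContinuousOn.circleIntegrable' (ContinuousOn.smul ?_ hcont)
    exact Complex.continuous_re.comp_continuousOn (continuousOn_herglotzRieszKernel_sphere hwb)
  · refine ContinuousOn.circleIntegrable' ?_
    exact ((continuous_posLog.comp hg.continuous.norm).const_smul (3 : ℝ)).continuousOn
  · intro z hz
    rw [abs_of_pos hR] at hz
    have h1 := re_herglotzRieszKernel_le hz hwb
    have h2 := le_re_herglotzRieszKernel hz hwb
    simp only [sub_zero] at h1 h2
    have h3 : (R + ‖w‖) / (R - ‖w‖) ≤ 3 := by
      rw [div_le_iff₀ (by linarith)]; linarith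
    have h4 : 0 ≤ (R - ‖w‖) / (R + ‖w‖) :=
      div_nonneg (by linarith) (by positivity)
    simp only [Pi.smul_apply', Function.comp_apply, herglotzRieszKernel_def, sub_zero, smul_eq_mul]
    have h5 : Real.log ‖g z‖ ≤ Real.posLog ‖g z‖ := le_max_right _ _
    have h6 : 0 ≤ Real.posLog ‖g z‖ := posLog_nonneg
    nlinarith

theorem sq_norm_blaschke (R : ℝ) (a z : ℂ) :
    ‖(R : ℂ) ^ 2 - (starRingEnd ℂ) a * z‖ ^ 2 =
      R ^ 2 * ‖z - a‖ ^ 2 + (R ^ 2 - ‖a‖ ^ 2) * (R ^ 2 - ‖z‖ ^ 2) := by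
  simp only [← Complex.normSq_eq_norm_sq, Complex.normSq_apply, Complex.sub_re, Complex.sub_im,
    Complex.mul_re, Complex.mul_im, Complex.conj_re, Complex.conj_im, ← Complex.ofReal_pow,
    Complex.ofReal_re, Complex.ofReal_im]
  ring

/-- Each factor z - a is replaced by (R² - āz)/R, which has the same modulus on |z| = R, a larger or
equal one inside, and no zero in the closed disc. This reduces to the zero-free case without
changing the circle average. -/
theorem log_norm_le_circleAverage {f : ℂ → ℂ} (hf : Differentiable ℂ f) {R : ℝ}
    (hR : 0 < R) (h : ∀ z, ‖z‖ = R → f z ≠ 0) {w : ℂ} (hw : ‖w‖ ≤ R / 2) :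
    Real.log ‖f w‖ ≤ 3 * circleAverage (fun z => Real.posLog ‖f z‖) 0 R := by
  have h0 : f ≠ 0 := by
    rintro rfl
    exact h (R : ℂ) (by simp [abs_of_pos hR]) rfl
  obtain ⟨g, hg, hfg, hg0⟩ := exists_eq_prod_zeroFinset_mul hf h0 R
  set S := zeroFinset f R
  set m := analyticOrderNatAt f
  have hSR : ∀ a ∈ S, ‖a‖ < R := fun a ha => by
    obtain ⟨h1, h2⟩ := (mem_zeroFinset hf h0).1 ha
    exact lt_of_le_of_ne h1 fun e => h a e h2
  set B : ℂ → ℂ → ℂ := fun a z => ((R : ℂ) ^ 2 - (starRingEnd ℂ) a * z) / R with hB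
  have hBn : ∀ a z, R ^ 2 * ‖B a z‖ ^ 2 = R ^ 2 * ‖z - a‖ ^ 2 +
      (R ^ 2 - ‖a‖ ^ 2) * (R ^ 2 - ‖z‖ ^ 2) := fun a z => by
    rw [← sq_norm_blaschke]
    simp only [hB, norm_div, Complex.norm_real, Real.norm_eq_abs, div_pow, sq_abs]
    field_simp
  have hBle : ∀ a ∈ S, ∀ z, ‖z‖ ≤ R → ‖z - a‖ ≤ ‖B a z‖ := fun a ha z hz => by
    have h1 := hBn a z
    have h2 : 0 ≤ (R ^ 2 - ‖a‖ ^ 2) * (R ^ 2 - ‖z‖ ^ 2) := by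
      have := hSR a ha
      apply mul_nonneg <;> nlinarith [norm_nonneg a, norm_nonneg z]
    have h3 : R ^ 2 * ‖z - a‖ ^ 2 ≤ R ^ 2 * ‖B a z‖ ^ 2 := by linarith
    have h4 := le_of_mul_le_mul_left h3 (by positivity)
    exact (sq_le_sq₀ (norm_nonneg _) (norm_nonneg _)).1 h4
  have hBeq : ∀ a z, ‖z‖ = R → ‖B a z‖ = ‖z - a‖ := fun a z hz => by
    have h1 := hBn a z
    rw [hz, sub_self, mul_zero, add_zero] at h1
    exact (sq_eq_sq₀ (norm_nonneg _) (norm_nonneg _)).1 (mul_left_cancel₀ (by positivity) h1)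
  have hBne : ∀ a ∈ S, ∀ z, ‖z‖ ≤ R → B a z ≠ 0 := fun a ha z hz h0 => by
    have h1 := hBle a ha z hz
    rw [h0, norm_zero] at h1
    have h2 : z = a := by simpa [sub_eq_zero] using h1
    have h3 := hBn a z
    rw [h0, h2] at h3
    have := hSR a ha
    simp only [norm_zero, sub_self] at h3
    have h4 : 0 < R ^ 2 - ‖a‖ ^ 2 := by nlinarith [norm_nonneg a]
    nlinarith
  set G : ℂ → ℂ := fun z => (∏ a ∈ S, B a z ^ m a) * g z with hG
  have hGd : Differentiable ℂ G := by
    simp only [hG, hB]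
    fun_prop
  have hG0 : ∀ z, ‖z‖ ≤ R → G z ≠ 0 := fun z hz =>
    mul_ne_zero (Finset.prod_ne_zero_iff.2 fun a ha => pow_ne_zero _ (hBne a ha z hz)) (hg0 z hz)
  have key := log_norm_le_circleAverage_of_ne_zero hGd hR hG0 hw
  have hle : ‖f w‖ ≤ ‖G w‖ := by
    rw [hfg, hG, norm_mul, norm_mul, norm_prod, norm_prod]
    refine mul_le_mul_of_nonneg_right ?_ (norm_nonneg _)
    refine Finset.prod_le_prod (fun _ _ => norm_nonneg _) fun a ha => ?_
    rw [norm_pow, norm_pow]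
    exact pow_le_pow_left₀ (norm_nonneg _) (hBle a ha w (by linarith)) _
  have heq : circleAverage (fun z => Real.posLog ‖G z‖) 0 R
      = circleAverage (fun z => Real.posLog ‖f z‖) 0 R := by
    refine circleAverage_congr_sphere fun z hz => ?_
    rw [abs_of_pos hR, mem_sphere_zero_iff_norm] at hz
    have : ‖G z‖ = ‖f z‖ := by
      rw [hfg, hG, norm_mul, norm_mul, norm_prod, norm_prod]
      congr 1
      refine Finset.prod_congr rfl fun a _ => ?_
      rw [norm_pow, norm_pow, hBeq a z hz]
    simp only [this]
  rw [← heq]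
  -- Here log 0 = 0, so at a zero the claim is only that the right side is nonnegative.
  by_cases hfw : f w = 0
  · rw [hfw, norm_zero, Real.log_zero]
    exact mul_nonneg (by norm_num) (circleAverage_nonneg_of_nonneg fun _ _ => posLog_nonneg)
  · exact (Real.log_le_log (norm_pos_iff.2 hfw) hle).trans key

theorem growthOrder_nonneg (f : ℂ → ℂ) : 0 ≤ growthOrder f := by
  refine le_trans ?_ (Filter.liminf_le_limsup)
  refine Filter.le_liminf_of_le (by isBoundedDefault) ?_
  filter_upwards [eventually_ge_atTop 1] with r hr
  exact_mod_cast div_nonneg posLog_nonneg (Real.log_nonneg hr)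

theorem characteristic_eq_circleAverage {f : ℂ → ℂ} (hf : Differentiable ℂ f) (r : ℝ) :
    ValueDistribution.characteristic f ⊤ r = circleAverage (fun z => Real.posLog ‖f z‖) 0 r := by
  have h : MeromorphicOn.divisor f univ ≥ 0 :=
    MeromorphicOn.AnalyticOnNhd.divisor_nonneg (fun z _ => hf.analyticAt z)
  have h2 : (MeromorphicOn.divisor f univ)⁻ = 0 := negPart_eq_zero.2 h
  simp [ValueDistribution.characteristic, ValueDistribution.proximity_top,
    ValueDistribution.logCounting_top, h2]

theorem eventually_circleAverage_le {f : ℂ → ℂ} (hf : Differentiable ℂ f) {τ : ℝ}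
    (h : growthOrder f < τ) :
    ∀ᶠ r in atTop, circleAverage (fun z => Real.posLog ‖f z‖) 0 r ≤ r ^ τ := by
  filter_upwards [Filter.eventually_lt_of_limsup_lt h (by isBoundedDefault),
    eventually_gt_atTop 1] with r hr hr1
  rw [← characteristic_eq_circleAverage hf]
  set T := ValueDistribution.characteristic f ⊤ r
  have hl : 0 < Real.log r := Real.log_pos hr1
  have h1 : Real.posLog T / Real.log r < τ := by exact_mod_cast hr
  rw [div_lt_iff₀ hl] at h1
  rcases le_or_gt T 0 with hT | hT
  · exact hT.trans (by positivity)
  · rw [← Real.log_le_log_iff hT (by positivity), Real.log_rpow (by linarith)]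
    exact (le_max_right _ _).trans h1.le

/-- An entire function of order less than `τ` satisfies `log |f(z)| ≤ 3 (4 r) ^ τ` in the disc of
radius `r`, for large `r`. -/
theorem eventually_norm_le_exp {f : ℂ → ℂ} (hf : Differentiable ℂ f) (h0 : f ≠ 0) {τ : ℝ}
    (h : growthOrder f < τ) :
    ∀ᶠ r : ℝ in atTop, ∀ z, ‖z‖ ≤ r → ‖f z‖ ≤ Real.exp (3 * (4 * r) ^ τ) := by
  have hτ : 0 < τ := by exact_mod_cast (growthOrder_nonneg f).trans_lt h
  obtain ⟨R₀, hR₀⟩ := eventually_atTop.1 (eventually_circleAverage_le hf h)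
  filter_upwards [eventually_ge_atTop R₀, eventually_gt_atTop 0] with r hr hr0 z hz
  -- The estimate needs a circle free of zeros; the moduli of the zeros are countable, so the
  -- interval contains such a radius.
  obtain ⟨R, hR, hRz⟩ : ∃ R ∈ Ioo (2 * r) (4 * r), R ∉ norm '' {w | f w = 0} := by
    by_contra! hcon
    have : (Ioo (2 * r) (4 * r)).Countable :=
      ((countable_zeros hf h0).image _).mono hcon
    have h0 := this.measure_zero MeasureTheory.volume
    rw [Real.volume_Ioo, ENNReal.ofReal_eq_zero] at h0
    linarith
  have hne : ∀ w, ‖w‖ = R → f w ≠ 0 := fun w hw hw0 => hRz ⟨w, hw0, hw⟩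
  have h1 := log_norm_le_circleAverage hf (by linarith [hR.1]) hne (w := z) (by linarith [hR.1])
  have h2 := hR₀ R (by linarith [hR.1])
  have h3 : R ^ τ ≤ (4 * r) ^ τ := Real.rpow_le_rpow (by linarith [hR.1]) hR.2.le hτ.le
  rcases eq_or_ne (f z) 0 with h4 | h4
  · rw [h4, norm_zero]; positivity
  · rw [← Real.log_le_iff_le_exp (norm_pos_iff.2 h4)]
    linarith

/-! ### Jensen's formula and the number of zeros -/

/-- Jensen's formula for entire functions; at a zero `w = 0` we use `log 0 = 0`. -/
theorem circleAverage_log_norm_eq {f : ℂ → ℂ} (hf : Differentiable ℂ f) (h0 : f ≠ 0) {r : ℝ}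
    (hr : 0 < r) :
    circleAverage (fun z => Real.log ‖f z‖) 0 r =
      ∑ w ∈ zeroFinset f r, analyticOrderNatAt f w * (Real.log r - Real.log ‖w‖) +
        Real.log ‖meromorphicTrailingCoeffAt f 0‖ := by
  have han : AnalyticOnNhd ℂ f (closedBall 0 |r|) := fun z _ => hf.analyticAt z
  have hfin := (MeromorphicOn.divisor f (closedBall 0 |r|)).finiteSupport
    (isCompact_closedBall 0 |r|)
  rw [MeromorphicOn.circleAverage_log_norm hr.ne' han.meromorphicOn,
    ← countingFunction_finsum_eq_finsum_add hr.ne' hfin]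
  congr 1
  have hdiv : ∀ w, ‖w‖ ≤ r → MeromorphicOn.divisor f (closedBall 0 |r|) w
      = analyticOrderNatAt f w := fun w hw => by
    rw [MeromorphicOn.AnalyticOnNhd.divisor_apply han (by simpa [abs_of_pos hr] using hw),
      ← Nat.cast_analyticOrderNatAt (order_ne_top hf h0 w)]
    simp
  rw [finsum_eq_sum_of_support_subset (s := zeroFinset f r)]
  · refine Finset.sum_congr rfl fun w hw => ?_
    rw [hdiv w ((mem_zeroFinset hf h0).1 hw).1]
    simp
  · intro w hw
    rw [Function.mem_support] at hw
    have hw1 : MeromorphicOn.divisor f (closedBall 0 |r|) w ≠ 0 := by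
      intro h; rw [h] at hw; simp at hw
    have hwr : ‖w‖ ≤ r := by
      by_contra hcon
      exact hw1 (Function.locallyFinsuppWithin.apply_eq_zero_of_notMem _
        (by simpa [abs_of_pos hr] using hcon))
    refine Finset.mem_coe.2 ((mem_zeroFinset hf h0).2 ⟨hwr, ?_⟩)
    by_contra hcon
    rw [hdiv w hwr, (orderNat_eq_zero_iff hf h0 w).2 hcon] at hw1
    exact hw1 rfl

/-- The number of zeros of an entire function of order less than `τ` in the disc of radius `r` is
`O(r ^ τ)`. -/
theorem exists_sum_order_le {f : ℂ → ℂ} (hf : Differentiable ℂ f) (h0 : f ≠ 0) {τ : ℝ}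
    (h : growthOrder f < τ) :
    ∃ C : ℝ, 0 < C ∧ ∀ r : ℝ, 1 ≤ r →
      (∑ w ∈ zeroFinset f r, (analyticOrderNatAt f w : ℝ)) ≤ C * r ^ τ := by
  have hτ : 0 < τ := by exact_mod_cast (growthOrder_nonneg f).trans_lt h
  obtain ⟨R₀, hR₀⟩ := eventually_atTop.1 (eventually_circleAverage_le hf h)
  set κ := Real.log ‖meromorphicTrailingCoeffAt f 0‖
  set R₁ := max R₀ 1
  have hmono : ∀ {r s : ℝ}, r ≤ s → (∑ w ∈ zeroFinset f r, (analyticOrderNatAt f w : ℝ)) ≤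
      ∑ w ∈ zeroFinset f s, (analyticOrderNatAt f w : ℝ) := fun {r s} hrs => by
    refine Finset.sum_le_sum_of_subset_of_nonneg (fun w hw => ?_) fun _ _ _ => by positivity
    rw [mem_zeroFinset hf h0] at hw ⊢
    exact ⟨hw.1.trans hrs, hw.2⟩
  have hbig : ∀ r, R₁ ≤ r → (∑ w ∈ zeroFinset f r, (analyticOrderNatAt f w : ℝ)) ≤
      ((2 ^ τ + |κ|) / Real.log 2) * r ^ τ := fun r hr => by
    have hr1 : 1 ≤ r := (le_max_right _ _).trans hr
    have h2r : 0 < 2 * r := by linarith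
    have hJ := circleAverage_log_norm_eq hf h0 h2r
    have hT : circleAverage (fun z => Real.log ‖f z‖) 0 (2 * r) ≤ (2 * r) ^ τ := by
      refine le_trans ?_ (hR₀ (2 * r) (by linarith [(le_max_left R₀ 1).trans hr]))
      refine circleAverage_mono ?_ ?_ fun z _ => le_max_right _ _
      · exact MeromorphicOn.circleIntegrable_log_norm fun z _ => (hf.analyticAt z).meromorphicAt
      · exact (continuous_posLog.comp hf.continuous.norm).continuousOn.circleIntegrable'
    have hrt : 1 ≤ r ^ τ := Real.one_le_rpow hr1 hτ.le
    -- In Jensen's formula at radius 2r every zero in the disc of radius r has weight at least log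
    -- 2.
    have hlow : (∑ w ∈ zeroFinset f r, (analyticOrderNatAt f w : ℝ)) * Real.log 2 ≤
        ∑ w ∈ zeroFinset f (2 * r), analyticOrderNatAt f w * (Real.log (2 * r) - Real.log ‖w‖) := by
      rw [Finset.sum_mul]
      refine (Finset.sum_le_sum fun w hw => ?_).trans
        (Finset.sum_le_sum_of_subset_of_nonneg (s := zeroFinset f r) (fun w hw => ?_)
          fun w hw _ => ?_)
      · refine mul_le_mul_of_nonneg_left ?_ (by positivity)
        rw [Real.log_mul (by norm_num) (by linarith)]
        have : Real.log ‖w‖ ≤ Real.log r := by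
          rcases (norm_nonneg w).eq_or_lt with h | h
          · rw [← h, Real.log_zero]; exact Real.log_nonneg hr1
          · exact Real.log_le_log h ((mem_zeroFinset hf h0).1 hw).1
        linarith
      · rw [mem_zeroFinset hf h0] at hw ⊢
        exact ⟨hw.1.trans (by linarith), hw.2⟩
      · refine mul_nonneg (by positivity) (sub_nonneg.2 ?_)
        rcases (norm_nonneg w).eq_or_lt with h | h
        · rw [← h, Real.log_zero]; exact Real.log_nonneg (by linarith)
        · exact Real.log_le_log h ((mem_zeroFinset hf h0).1 hw).1
    have hl2 : 0 < Real.log 2 := Real.log_pos (by norm_num)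
    rw [div_mul_eq_mul_div, le_div_iff₀ hl2]
    rw [Real.mul_rpow (by norm_num) (by linarith)] at hT
    have : -κ ≤ |κ| * r ^ τ := by
      have := neg_le_abs κ
      nlinarith [abs_nonneg κ]
    nlinarith
  have hC : 0 < (2 ^ τ + |κ|) / Real.log 2 :=
    div_pos (by positivity) (Real.log_pos (by norm_num))
  -- The extra factor R₁^τ covers 1 ≤ r ≤ R₁, where the count is at most that at R₁.
  refine ⟨(2 ^ τ + |κ|) / Real.log 2 * R₁ ^ τ, ?_, fun r hr => ?_⟩
  · have : 0 < R₁ := lt_of_lt_of_le one_pos (le_max_right _ _)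
    positivity
  · have hR1 : 1 ≤ R₁ := le_max_right _ _
    have h1 : 1 ≤ R₁ ^ τ := Real.one_le_rpow hR1 hτ.le
    have h2 : 1 ≤ r ^ τ := Real.one_le_rpow hr hτ.le
    rcases le_total R₁ r with h3 | h3
    · refine (hbig r h3).trans ?_
      refine mul_le_mul_of_nonneg_right ?_ (by linarith)
      nlinarith
    · refine ((hmono h3).trans (hbig R₁ le_rfl)).trans ?_
      have : 0 < (2 ^ τ + |κ|) / Real.log 2 * R₁ ^ τ := by positivity
      nlinarith

/-! ### Product representation for order less than 1 -/

/-- L is the primitive of g'/g vanishing at 0; then g exp(-L) has derivative 0. -/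
theorem exists_exp_eq_on_ball {g : ℂ → ℂ} (hg : Differentiable ℂ g) {r : ℝ} (hr : 0 < r)
    (h : ∀ z ∈ ball (0 : ℂ) r, g z ≠ 0) :
    ∃ L : ℂ → ℂ, DifferentiableOn ℂ L (ball 0 r) ∧ L 0 = 0 ∧
      ∀ z ∈ ball (0 : ℂ) r, g z = g 0 * Complex.exp (L z) := by
  have hd : Differentiable ℂ (deriv g) := fun z => ((hg.analyticAt z).deriv).differentiableAt
  have hq : DifferentiableOn ℂ (fun z => deriv g z / g z) (ball 0 r) :=
    hd.differentiableOn.div hg.differentiableOn h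
  obtain ⟨L, hL0, hL⟩ := hq.isExactOn_ball.with_val_at 0 0
  have hLd : DifferentiableOn ℂ L (ball 0 r) := fun z hz =>
    (hL z hz).differentiableAt.differentiableWithinAt
  refine ⟨L, hLd, hL0, fun z hz => ?_⟩
  have hder : ∀ w ∈ ball (0 : ℂ) r, HasDerivAt (fun z => g z * Complex.exp (-L z)) 0 w := by
    intro w hw
    have h1 := (hg w).hasDerivAt.mul (hL w hw).neg.cexp
    convert! h1 using 1
    field_simp [h w hw]
    ring
  have hconst := isOpen_ball.is_const_of_deriv_eq_zero (convex_ball (0 : ℂ) r).isPreconnected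
    (fun w hw => (hder w hw).differentiableAt.differentiableWithinAt)
    (fun w hw => (hder w hw).deriv) hz (mem_ball_self hr)
  simp only [hL0, neg_zero, Complex.exp_zero, mul_one] at hconst
  rw [← hconst, mul_assoc, ← Complex.exp_add]
  simp

/-- A zero-free function `g` on a disc with `|g| ≤ exp A |g(0)|` is close to `g(0)` near `0`. -/
theorem exists_exp_eq_of_norm_le {g : ℂ → ℂ} (hg : Differentiable ℂ g) {r A : ℝ} (hr : 0 < r)
    (hA : 0 < A) (h : ∀ z ∈ ball (0 : ℂ) r, g z ≠ 0)
    (hb : ∀ z ∈ ball (0 : ℂ) r, ‖g z‖ ≤ Real.exp A * ‖g 0‖) {z : ℂ} (hz : z ∈ ball (0 : ℂ) r) :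
    ∃ l : ℂ, g z = g 0 * Complex.exp l ∧ ‖l‖ ≤ 2 * A * ‖z‖ / (r - ‖z‖) := by
  obtain ⟨L, hL, hL0, hgL⟩ := exists_exp_eq_on_ball hg hr h
  refine ⟨L z, hgL z hz, Complex.borelCaratheodory_zero hA hL (fun w hw => ?_) hr hz hL0⟩
  have h1 := hb w hw
  have h2 : 0 < ‖g 0‖ := norm_pos_iff.2 (h 0 (mem_ball_self hr))
  rw [hgL w hw, norm_mul, Complex.norm_exp, mul_comm] at h1
  exact Real.exp_le_exp.1 (le_of_mul_le_mul_right h1 h2)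

/-- The product representation of an entire function of order less than `1`, normalised at an
arbitrary point `p` which is not a zero. -/
theorem tendsto_prod_zeroFinset {f : ℂ → ℂ} (hf : Differentiable ℂ f)
    (h : growthOrder f < 1) {p : ℂ} (hp : f p ≠ 0) (z : ℂ) :
    Tendsto (fun n : ℕ => ∏ w ∈ zeroFinset f n, ((z - w) / (p - w)) ^ analyticOrderNatAt f w)
      atTop (𝓝 (f z / f p)) := by
  have h0 : f ≠ 0 := by rintro rfl; exact hp rfl
  obtain ⟨τ, hτ, hτ1⟩ := EReal.lt_iff_exists_real_btwn.1 h
  have hτ0 : 0 < τ := by exact_mod_cast (growthOrder_nonneg f).trans_lt hτ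
  replace hτ1 : τ < 1 := by exact_mod_cast hτ1
  set m := analyticOrderNatAt f
  set κ := |Real.log ‖f p‖|
  -- The first term bounds log|f| on the disc of radius 2R + |p|, and κ makes the bound relative to
  -- |f(p)|. `B` is the resulting Borel–Carathéodory bound, of size O(R^(τ-1)).
  set A : ℝ → ℝ := fun R => 3 * (4 * (2 * R + ‖p‖)) ^ τ + κ with hA
  set B : ℝ → ℝ := fun R => 2 * A R * ‖z - p‖ / (R - ‖p‖ - ‖z - p‖) with hB
  have hBlim : Tendsto B atTop (𝓝 0) := by
    set D := ‖z - p‖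
    have h1 : Tendsto (fun R : ℝ => D * (12 * 12 ^ τ * R ^ (-(1 - τ)) + 4 * κ * R⁻¹)) atTop
        (𝓝 (D * (12 * 12 ^ τ * 0 + 4 * κ * 0))) :=
      (((tendsto_rpow_neg_atTop (by linarith : 0 < 1 - τ)).const_mul _).add
        (tendsto_inv_atTop_zero.const_mul _)).const_mul _
    simp only [mul_zero, add_zero] at h1
    have hD : 0 ≤ D := norm_nonneg _
    have hκ : 0 ≤ κ := abs_nonneg _
    have hP := norm_nonneg p
    refine squeeze_zero' ?_ ?_ h1
    · filter_upwards [eventually_gt_atTop (‖p‖ + D)] with R hR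
      have : 0 ≤ 4 * (2 * R + ‖p‖) := by linarith
      simp only [hB, hA]
      have := Real.rpow_nonneg this τ
      exact div_nonneg (by positivity) (by linarith)
    · filter_upwards [eventually_gt_atTop (2 * (‖p‖ + D)), eventually_gt_atTop 0] with R hR hR0
      have h2 : (4 * (2 * R + ‖p‖)) ^ τ ≤ 12 ^ τ * R ^ τ := by
        rw [← Real.mul_rpow (by norm_num) hR0.le]
        exact Real.rpow_le_rpow (by linarith) (by linarith) hτ0.le
      have h3 : R ^ (-(1 - τ)) = R ^ τ / R := by
        rw [neg_sub, Real.rpow_sub_one hR0.ne']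
      have h4 : 0 ≤ (12 : ℝ) ^ τ * R ^ τ := by positivity
      calc B R ≤ 2 * (3 * (12 ^ τ * R ^ τ) + κ) * D / (R / 2) := by
            simp only [hB, hA]
            gcongr
            linarith
        _ = _ := by
            rw [h3]
            field_simp
            ring
  have hev : ∀ᶠ R : ℝ in atTop, ∃ l : ℂ, ‖l‖ ≤ B R ∧
      f z / f p = (∏ w ∈ zeroFinset f R, ((z - w) / (p - w)) ^ m w) * Complex.exp l := by
    have ht : Tendsto (fun R : ℝ => 2 * R + ‖p‖) atTop atTop :=
      tendsto_atTop_add_const_right _ _ (tendsto_id.const_mul_atTop two_pos)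
    filter_upwards [ht.eventually (eventually_norm_le_exp hf h0 hτ),
      eventually_gt_atTop (‖p‖ + ‖z - p‖)] with R hR hRp
    have hR0 : 0 < R := lt_of_le_of_lt (by positivity) hRp
    obtain ⟨g, hg, hfg, hg0⟩ := exists_eq_prod_zeroFinset_mul hf h0 R
    set S := zeroFinset f R
    have hS : ∀ w ∈ S, ‖w‖ ≤ R ∧ p - w ≠ 0 := fun w hw => by
      obtain ⟨h1, h2⟩ := (mem_zeroFinset hf h0).1 hw
      refine ⟨h1, sub_ne_zero.2 ?_⟩
      rintro rfl
      exact hp h2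
    set c := ∏ w ∈ S, (p - w) ^ m w with hc
    have hc0 : c ≠ 0 := Finset.prod_ne_zero_iff.2 fun w hw => pow_ne_zero _ (hS w hw).2
    -- The zero-free cofactor, recentred at p and normalised so that k(0) = f(p).
    set k : ℂ → ℂ := fun y => c * g (y + p) with hk
    have hkd : Differentiable ℂ k := by fun_prop
    have hfk : ∀ y, f y = (∏ w ∈ S, ((y - w) / (p - w)) ^ m w) * k (y - p) := fun y => by
      simp only [hk, sub_add_cancel, div_pow, Finset.prod_div_distrib]
      rw [hfg y, ← hc]
      field_simp
      exact mul_comm _ _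
    have hkp : k 0 = f p := by
      rw [hfk p, sub_self]
      rw [Finset.prod_eq_one, one_mul]
      intro w hw
      rw [div_self (hS w hw).2, one_pow]
    have hkb : ∀ y, ‖y‖ ≤ 2 * R + ‖p‖ → ‖k (y - p)‖ ≤ Real.exp (3 * (4 * (2 * R + ‖p‖)) ^ τ) := by
      intro y hy
      -- Maximum principle: on |y| = 2R + |p| one has |y-w| ≥ R + |p| ≥ |p-w| for every w in S, so
      -- the product has modulus at least 1 and |k(y-p)| ≤ |f(y)|.
      have hfr : 2 * R + ‖p‖ ≠ 0 := by positivity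
      refine Complex.norm_le_of_forall_mem_frontier_norm_le (f := fun y => k (y - p))
        (U := ball 0 (2 * R + ‖p‖)) isBounded_ball
        (Differentiable.diffContOnCl (by fun_prop)) (fun y hy => ?_) ?_
      · rw [frontier_ball _ hfr, mem_sphere_zero_iff_norm] at hy
        refine le_trans ?_ (hR y hy.le)
        have hn : ‖f y‖ = (∏ w ∈ S, ‖((y - w) / (p - w)) ^ m w‖) * ‖k (y - p)‖ := by
          rw [hfk y, ← norm_prod]
          exact norm_mul _ _
        rw [hn]
        refine le_mul_of_one_le_left (norm_nonneg _) ?_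
        rw [← Finset.prod_const_one (s := S)]
        refine Finset.prod_le_prod (fun _ _ => zero_le_one) fun w hw => ?_
        rw [norm_pow, norm_div]
        refine one_le_pow₀ ((one_le_div (norm_pos_iff.2 (hS w hw).2)).2 ?_)
        linarith [norm_sub_norm_le y w, norm_sub_le p w, (hS w hw).1]
      · rw [closure_ball _ hfr]
        simpa using hy
    have hk0 : ∀ y ∈ ball (0 : ℂ) (R - ‖p‖), k y ≠ 0 := fun y hy => by
      refine mul_ne_zero hc0 (hg0 _ ?_)
      rw [mem_ball_zero_iff] at hy
      linarith [norm_add_le y p]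
    have hkb' : ∀ y ∈ ball (0 : ℂ) (R - ‖p‖), ‖k y‖ ≤ Real.exp (A R) * ‖k 0‖ := fun y hy => by
      rw [mem_ball_zero_iff] at hy
      have h1 := hkb (y + p) (by linarith [norm_add_le y p, norm_nonneg p])
      rw [add_sub_cancel_right] at h1
      refine h1.trans ?_
      rw [hkp, hA, Real.exp_add, mul_assoc]
      refine le_mul_of_one_le_right (Real.exp_pos _).le ?_
      have hfp := norm_pos_iff.2 hp
      calc (1 : ℝ) = Real.exp (-Real.log ‖f p‖) * ‖f p‖ := by
            rw [Real.exp_neg, Real.exp_log hfp, inv_mul_cancel₀ hfp.ne']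
        _ ≤ _ := by
            gcongr
            exact neg_le_abs _
    have hA0 : 0 < A R := by
      simp only [hA]
      have : 0 < 4 * (2 * R + ‖p‖) := by positivity
      have := Real.rpow_pos_of_pos this τ
      positivity
    obtain ⟨l, hl, hl'⟩ := exists_exp_eq_of_norm_le hkd (by linarith [norm_nonneg (z - p)]) hA0 hk0
      hkb' (z := z - p) (by rw [mem_ball_zero_iff]; linarith)
    refine ⟨l, hl', ?_⟩
    rw [hfk z, hl, hkp]
    field_simp
  have hev' := (tendsto_natCast_atTop_atTop (R := ℝ)).eventually hev
  have hBn := hBlim.comp (tendsto_natCast_atTop_atTop (R := ℝ))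
  -- The exponent exists only for large n; its values at other n are irrelevant to the limit.
  choose! l hl hfl using fun n : ℕ => show
    (∃ l : ℂ, ‖l‖ ≤ B n ∧ f z / f p = (∏ w ∈ zeroFinset f n, ((z - w) / (p - w)) ^ m w) *
      Complex.exp l) → _ from id
  have hl0 : Tendsto l atTop (𝓝 0) :=
    squeeze_zero_norm' (hev'.mono fun n hn => hl n hn) hBn
  have hlim : Tendsto (fun n => f z / f p * Complex.exp (-l n)) atTop (𝓝 (f z / f p)) := by
    have := ((Complex.continuous_exp.tendsto _).comp hl0.neg).const_mul (f z / f p)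
    simpa using this
  refine hlim.congr' (hev'.mono fun n hn => ?_)
  rw [hfl n hn, mul_assoc, ← Complex.exp_add]
  simp

/-! ### Integrals behind the exceptional set -/

theorem setLIntegral_lt_top_of_le {s : Set ℝ} (hs : MeasurableSet s) {F : ℝ → ℝ≥0∞} {g : ℝ → ℝ}
    (hg : IntegrableOn g s) (h : ∀ x ∈ s, F x ≤ ENNReal.ofReal (g x)) :
    ∫⁻ x in s, F x < ∞ :=
  (setLIntegral_mono' hs h).trans_lt hg.lintegral_lt_top

theorem div_two_rpow_neg {x : ℝ} (hx : 0 ≤ x) (a : ℝ) : (x / 2) ^ (-a) = 2 ^ a * x ^ (-a) := by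
  rw [div_rpow hx (by norm_num), rpow_neg (by norm_num : (0 : ℝ) ≤ 2) a, div_inv_eq_mul, mul_comm]

/-- The three conditions give convergence at 1, at 0 and at infinity respectively. -/
theorem lintegral_abs_sub_one_rpow_lt_top {α β : ℝ} (hα1 : α < 1)
    (hβ1 : β < 1) (hαβ : 1 < α + β) :
    ∫⁻ x in Ioi (0 : ℝ), ENNReal.ofReal |x - 1| ^ (-α) * ENNReal.ofReal (x ^ (-β)) < ∞ := by
  set F : ℝ → ℝ≥0∞ := fun x => ENNReal.ofReal |x - 1| ^ (-α) * ENNReal.ofReal (x ^ (-β))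
  have hF : ∀ x : ℝ, x ≠ 1 → F x = ENNReal.ofReal (|x - 1| ^ (-α) * x ^ (-β)) := fun x hx => by
    have : 0 < |x - 1| := abs_pos.2 (sub_ne_zero.2 hx)
    rw [ENNReal.ofReal_mul (by positivity), ← ENNReal.ofReal_rpow_of_pos this]
  have hsub : Ioi (0 : ℝ) ⊆ Ioc 0 (1 / 2) ∪ Ioo (1 / 2) 1 ∪ {1} ∪ Ioc 1 2 ∪ Ioi 2 := by
    intro x hx
    simp only [mem_union, mem_Ioc, mem_Ioo, mem_singleton_iff, mem_Ioi] at hx ⊢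
    grind
  have hI : IntervalIntegrable (fun x : ℝ => x ^ (-α)) volume 0 1 :=
    intervalIntegral.intervalIntegrable_rpow' (by linarith)
  have h1 : ∫⁻ x in Ioc (0 : ℝ) (1 / 2), F x < ∞ := by
    have hJ : IntervalIntegrable (fun x : ℝ => x ^ (-β)) volume 0 (1 / 2) :=
      intervalIntegral.intervalIntegrable_rpow' (by linarith)
    refine setLIntegral_lt_top_of_le measurableSet_Ioc (hJ.1.const_mul ((1 / 2) ^ (-α)))
      fun x hx => ?_
    rw [hF x (by linarith [hx.2])]
    refine ENNReal.ofReal_le_ofReal (mul_le_mul_of_nonneg_right ?_ (rpow_nonneg hx.1.le _))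
    refine rpow_le_rpow_of_nonpos (by norm_num) ?_ (by linarith)
    rw [abs_of_nonpos (by linarith [hx.2])]
    linarith [hx.2]
  have h2 : ∫⁻ x in Ioo (1 / 2 : ℝ) 1, F x < ∞ := by
    have hJ := (hI.comp_sub_left 1).symm.1
    norm_num only at hJ
    refine setLIntegral_lt_top_of_le measurableSet_Ioo
      ((hJ.mono_set (t := Ioc 0 1) (s := Ioo (1 / 2) 1) fun x hx => ⟨by linarith [hx.1], hx.2.le⟩).mul_const
        ((1 / 2) ^ (-β))) fun x hx => ?_
    rw [hF x hx.2.ne, abs_of_neg (by linarith [hx.2]), neg_sub]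
    refine ENNReal.ofReal_le_ofReal (mul_le_mul_of_nonneg_left ?_
      (rpow_nonneg (by linarith [hx.2]) _))
    exact rpow_le_rpow_of_nonpos (by norm_num) hx.1.le (by linarith)
  have h3 : ∫⁻ x in Ioc (1 : ℝ) 2, F x < ∞ := by
    have hJ := (hI.comp_sub_right 1).1
    norm_num only at hJ
    refine setLIntegral_lt_top_of_le measurableSet_Ioc hJ fun x hx => ?_
    rw [hF x hx.1.ne', abs_of_pos (by linarith [hx.1])]
    refine ENNReal.ofReal_le_ofReal (mul_le_of_le_one_right (rpow_nonneg (by linarith [hx.1]) _) ?_)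
    exact rpow_le_one_of_one_le_of_nonpos hx.1.le (by linarith)
  have h4 : ∫⁻ x in Ioi (2 : ℝ), F x < ∞ := by
    have hJ := integrableOn_Ioi_rpow_of_lt (a := -α - β) (c := 2) (by linarith) (by norm_num)
    refine setLIntegral_lt_top_of_le measurableSet_Ioi (hJ.const_mul (2 ^ α)) fun x hx => ?_
    have hx : 2 < x := hx
    rw [hF x (by linarith), abs_of_pos (by linarith)]
    refine ENNReal.ofReal_le_ofReal ?_
    have h5 : (x - 1) ^ (-α) ≤ (x / 2) ^ (-α) :=
      rpow_le_rpow_of_nonpos (by linarith) (by linarith) (by linarith)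
    rw [div_two_rpow_neg (by linarith)] at h5
    have h6 := mul_le_mul_of_nonneg_right h5 (rpow_nonneg (by linarith : (0 : ℝ) ≤ x) (-β))
    refine h6.trans (le_of_eq ?_)
    rw [sub_eq_add_neg, rpow_add (by linarith)]
    ring
  have h5 : ∫⁻ x in ({1} : Set ℝ), F x < ∞ := by simp
  refine (lintegral_mono_set hsub).trans_lt ?_
  refine (lintegral_union_le _ _ _).trans_lt (ENNReal.add_lt_top.2 ⟨?_, h4⟩)
  refine (lintegral_union_le _ _ _).trans_lt (ENNReal.add_lt_top.2 ⟨?_, h3⟩)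
  refine (lintegral_union_le _ _ _).trans_lt (ENNReal.add_lt_top.2 ⟨?_, h5⟩)
  exact (lintegral_union_le _ _ _).trans_lt (ENNReal.add_lt_top.2 ⟨h1, h2⟩)

theorem setLIntegral_Ioi_zero_comp_mul_left (F : ℝ → ℝ≥0∞) (hF : Measurable F) {s : ℝ}
    (hs : 0 < s) :
    ∫⁻ x in Ioi (0 : ℝ), F x = ENNReal.ofReal s * ∫⁻ x in Ioi (0 : ℝ), F (s * x) := by
  have h := Real.smul_map_volume_mul_left hs.ne'
  have hm : Measurable fun x : ℝ => s * x := measurable_const_mul s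
  calc ∫⁻ x in Ioi (0 : ℝ), F x = ∫⁻ x, (Ioi (0 : ℝ)).indicator F x := by
        rw [lintegral_indicator measurableSet_Ioi]
    _ = ENNReal.ofReal s * ∫⁻ x, (Ioi (0 : ℝ)).indicator F (s * x) := by
        conv_lhs => rw [← h]
        rw [lintegral_smul_measure, lintegral_map (hF.indicator measurableSet_Ioi) hm,
          abs_of_pos hs, smul_eq_mul]
    _ = _ := by
        rw [← lintegral_indicator measurableSet_Ioi]
        congr 2
        funext x
        simp [indicator, hs]

/-- This is the contribution of one zero of modulus s to the exceptional set. For s ≥ 1/2 the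
substitution t = s x extracts s^(-σ) and leaves a convergent integral independent of s; for s < 1/2
one has t - s ≥ t/2, and the integrand is at most a multiple of t^(-σ-1). -/
theorem exists_lintegral_abs_sub_rpow_le {α σ : ℝ} (hα1 : α < 1) (hσ : 0 < σ)
    (hσα : σ < α) :
    ∃ K : ℝ≥0∞, K < ∞ ∧ ∀ s : ℝ, 0 ≤ s →
      ∫⁻ t in Ioi (1 : ℝ), ENNReal.ofReal |t - s| ^ (-α) * ENNReal.ofReal (t ^ (α - σ - 1))
        ≤ K * ENNReal.ofReal (max 1 s ^ (-σ)) := by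
  set I : ℝ≥0∞ := ∫⁻ x in Ioi (0 : ℝ),
    ENNReal.ofReal |x - 1| ^ (-α) * ENNReal.ofReal (x ^ (-(1 - α + σ))) with hI
  have hIlt : I < ∞ := lintegral_abs_sub_one_rpow_lt_top hα1 (by linarith)
    (by linarith)
  set K₂ : ℝ≥0∞ := ∫⁻ t in Ioi (1 : ℝ), ENNReal.ofReal (2 ^ α * t ^ (-σ - 1)) with hK₂
  have hK₂lt : K₂ < ∞ := setLIntegral_lt_top_of_le measurableSet_Ioi
    ((integrableOn_Ioi_rpow_of_lt (a := -σ - 1) (c := 1) (by linarith) one_pos).const_mul (2 ^ α))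
    fun x _ => le_rfl
  refine ⟨K₂ + ENNReal.ofReal (2 ^ σ) * I,
    ENNReal.add_lt_top.2 ⟨hK₂lt, ENNReal.mul_lt_top ENNReal.ofReal_lt_top hIlt⟩, fun s hs => ?_⟩
  rcases lt_or_ge s (1 / 2) with h | h
  · rw [max_eq_left (by linarith), one_rpow, ENNReal.ofReal_one, mul_one]
    refine le_trans ?_ le_self_add
    refine setLIntegral_mono' measurableSet_Ioi fun t ht => ?_
    have ht : 1 < t := ht
    rw [abs_of_pos (by linarith), ENNReal.ofReal_rpow_of_pos (by linarith),
      ← ENNReal.ofReal_mul (rpow_nonneg (by linarith) _)]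
    refine ENNReal.ofReal_le_ofReal ?_
    have h5 : (t - s) ^ (-α) ≤ (t / 2) ^ (-α) :=
      rpow_le_rpow_of_nonpos (by linarith) (by linarith) (by linarith)
    rw [div_two_rpow_neg (by linarith)] at h5
    have h6 := mul_le_mul_of_nonneg_right h5
      (rpow_nonneg (by linarith : (0 : ℝ) ≤ t) (α - σ - 1))
    refine h6.trans (le_of_eq ?_)
    rw [show -σ - 1 = -α + (α - σ - 1) by ring, rpow_add (by linarith)]
    ring
  · have hs0 : 0 < s := by linarith
    calc ∫⁻ t in Ioi (1 : ℝ), ENNReal.ofReal |t - s| ^ (-α) * ENNReal.ofReal (t ^ (α - σ - 1))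
        ≤ ∫⁻ t in Ioi (0 : ℝ), ENNReal.ofReal |t - s| ^ (-α) * ENNReal.ofReal (t ^ (α - σ - 1)) :=
          lintegral_mono_set (Ioi_subset_Ioi zero_le_one)
      _ = ENNReal.ofReal s * ∫⁻ x in Ioi (0 : ℝ),
            ENNReal.ofReal |s * x - s| ^ (-α) * ENNReal.ofReal ((s * x) ^ (α - σ - 1)) :=
          setLIntegral_Ioi_zero_comp_mul_left _ (by fun_prop) hs0
      _ = ENNReal.ofReal s * ∫⁻ x in Ioi (0 : ℝ), ENNReal.ofReal (s ^ (-σ - 1)) *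
            (ENNReal.ofReal |x - 1| ^ (-α) * ENNReal.ofReal (x ^ (-(1 - α + σ)))) := by
          congr 1
          refine setLIntegral_congr_fun measurableSet_Ioi fun x hx => ?_
          have hx : 0 < x := hx
          have e1 : |s * x - s| = s * |x - 1| := by
            rw [← abs_of_pos hs0, ← abs_mul, abs_of_pos hs0]; ring_nf
          have e2 : s ^ (-σ - 1) = s ^ (-α) * s ^ (α - σ - 1) := by
            rw [← rpow_add hs0]; ring_nf
          rw [e1, ENNReal.ofReal_mul hs0.le, ENNReal.mul_rpow_of_ne_top ENNReal.ofReal_ne_top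
            ENNReal.ofReal_ne_top, mul_rpow hs0.le hx.le, ENNReal.ofReal_mul (by positivity), e2,
            ENNReal.ofReal_mul (by positivity), ENNReal.ofReal_rpow_of_pos hs0,
            show -(1 - α + σ) = α - σ - 1 by ring]
          ring
      _ = ENNReal.ofReal (s ^ (-σ)) * I := by
          rw [lintegral_const_mul' _ _ ENNReal.ofReal_ne_top, ← mul_assoc,
            ← ENNReal.ofReal_mul hs0.le, rpow_sub_one hs0.ne']
          congr 2
          field_simp
      _ ≤ ENNReal.ofReal (2 ^ σ * max 1 s ^ (-σ)) * I := by
          gcongr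
          have h1 : s ^ (-σ) ≤ (max 1 s / 2) ^ (-σ) := by
            refine rpow_le_rpow_of_nonpos (by positivity) ?_ (by linarith)
            have : max 1 s ≤ 2 * s := max_le (by linarith) (by linarith)
            linarith
          rwa [div_two_rpow_neg (by positivity)] at h1
      _ ≤ _ := by
          rw [ENNReal.ofReal_mul (by positivity), mul_right_comm]
          gcongr
          exact le_add_self

/-! ### Convergence of sums over the zeros -/

theorem sum_zeroFinset_le_tsum {f : ℂ → ℂ} (hf : Differentiable ℂ f) (h0 : f ≠ 0) (r : ℝ)
    (g : ℂ → ℝ≥0∞) :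
    ∑ w ∈ zeroFinset f r, g w ≤ ∑' w : {w | f w = 0}, g w := by
  rw [tsum_subtype {w | f w = 0} g]
  refine le_trans (le_of_eq ?_) (ENNReal.sum_le_tsum (zeroFinset f r))
  refine Finset.sum_congr rfl fun w hw => ?_
  rw [indicator_of_mem (show w ∈ {w | f w = 0} from ((mem_zeroFinset hf h0).1 hw).2)]

theorem tsum_le_sum_zeroFinset {f : ℂ → ℂ} (hf : Differentiable ℂ f) (h0 : f ≠ 0) (r : ℝ)
    (g : ℂ → ℝ≥0∞) (hg : ∀ w, f w = 0 → r < ‖w‖ → g w = 0) :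
    ∑' w : {w | f w = 0}, g w ≤ ∑ w ∈ zeroFinset f r, g w := by
  rw [tsum_subtype {w | f w = 0} g, tsum_eq_sum (s := zeroFinset f r)]
  · exact Finset.sum_le_sum fun w _ => indicator_le_self _ _ _
  · intro w hw
    by_cases h : f w = 0
    · rw [indicator_of_mem (show w ∈ {w | f w = 0} from h)]
      refine hg w h ?_
      by_contra! hr
      exact hw ((mem_zeroFinset hf h0).2 ⟨hr, h⟩)
    · exact indicator_of_notMem (s := {w | f w = 0}) h g

/-- The exponent of convergence of the zeros is at most the order. -/
theorem tsum_order_mul_rpow_lt_top {f : ℂ → ℂ} (hf : Differentiable ℂ f) (h0 : f ≠ 0) {σ : ℝ}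
    (h : growthOrder f < σ) :
    ∑' w : {w | f w = 0}, (analyticOrderNatAt f w : ℝ≥0∞) * ENNReal.ofReal (max 1 ‖(w : ℂ)‖ ^ (-σ))
      < ∞ := by
  have : Countable {w | f w = 0} := (countable_zeros hf h0).to_subtype
  obtain ⟨τ, hτ, hτσ⟩ := EReal.lt_iff_exists_real_btwn.1 h
  have hτ0 : 0 < τ := by exact_mod_cast (growthOrder_nonneg f).trans_lt hτ
  replace hτσ : τ < σ := by exact_mod_cast hτσ
  have hσ : 0 < σ := hτ0.trans hτσ
  obtain ⟨C, hC, hn⟩ := exists_sum_order_le hf h0 hτ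
  -- Writing c^(-σ) as the integral of σ t^(-σ-1) over t > c turns the sum over zeros into an
  -- integral of their counting function, which is O(t^τ) with τ < σ.
  have hker : ∀ c : ℝ, 1 ≤ c → ENNReal.ofReal (c ^ (-σ)) =
      ∫⁻ t in Ioi (1 : ℝ), (Ioi c).indicator (fun t => ENNReal.ofReal (σ * t ^ (-σ - 1))) t := by
    intro c hc
    rw [lintegral_indicator measurableSet_Ioi, Measure.restrict_restrict measurableSet_Ioi,
      inter_eq_left.2 (Ioi_subset_Ioi hc), ← ofReal_integral_eq_lintegral_ofReal]
    · rw [integral_const_mul, integral_Ioi_rpow_of_lt (by linarith) (by linarith)]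
      congr 1
      rw [show -σ - 1 + 1 = -σ by ring]
      field_simp
    · exact (integrableOn_Ioi_rpow_of_lt (by linarith) (by linarith)).const_mul σ
    · filter_upwards [ae_restrict_mem measurableSet_Ioi] with t ht
      have : 0 < t := by linarith [show c < t from ht]
      positivity
  have hmeas : ∀ c : ℝ, Measurable
      ((Ioi c).indicator (fun t : ℝ => ENNReal.ofReal (σ * t ^ (-σ - 1)))) := fun c =>
    Measurable.indicator (by fun_prop) measurableSet_Ioi
  calc ∑' w : {w | f w = 0}, (analyticOrderNatAt f w : ℝ≥0∞) *
        ENNReal.ofReal (max 1 ‖(w : ℂ)‖ ^ (-σ))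
      = ∑' w : {w | f w = 0}, ∫⁻ t in Ioi (1 : ℝ), (analyticOrderNatAt f w : ℝ≥0∞) *
          (Ioi (max 1 ‖(w : ℂ)‖)).indicator (fun t => ENNReal.ofReal (σ * t ^ (-σ - 1))) t := by
        refine tsum_congr fun w => ?_
        rw [hker _ (le_max_left _ _), lintegral_const_mul _ (hmeas _)]
    _ = ∫⁻ t in Ioi (1 : ℝ), ∑' w : {w | f w = 0}, (analyticOrderNatAt f w : ℝ≥0∞) *
          (Ioi (max 1 ‖(w : ℂ)‖)).indicator (fun t => ENNReal.ofReal (σ * t ^ (-σ - 1))) t := by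
        rw [lintegral_tsum]
        exact fun w => ((hmeas _).const_mul _).aemeasurable
    _ < ∞ := by
        refine setLIntegral_lt_top_of_le measurableSet_Ioi
          ((integrableOn_Ioi_rpow_of_lt (a := τ - σ - 1) (c := 1) (by linarith)
            one_pos).const_mul (C * σ)) fun t ht => ?_
        have ht : 1 < t := ht
        refine (tsum_le_sum_zeroFinset hf h0 t (fun w => (analyticOrderNatAt f w : ℝ≥0∞) *
          (Ioi (max 1 ‖(w : ℂ)‖)).indicator (fun t => ENNReal.ofReal (σ * t ^ (-σ - 1))) t)
          fun w _ hw => ?_).trans ?_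
        · rw [indicator_of_notMem, mul_zero]
          exact fun h => absurd ((le_max_right _ _).trans_lt (show max 1 ‖w‖ < t from h)) hw.not_gt
        · have hp : 0 ≤ σ * t ^ (-σ - 1) := by positivity
          calc _ ≤ ∑ w ∈ zeroFinset f t, ENNReal.ofReal
                (analyticOrderNatAt f w * (σ * t ^ (-σ - 1))) := by
                refine Finset.sum_le_sum fun w _ => ?_
                rw [ENNReal.ofReal_mul (by positivity), ENNReal.ofReal_natCast]
                gcongr
                exact indicator_le_self _ _ _
            _ = ENNReal.ofReal ((∑ w ∈ zeroFinset f t, (analyticOrderNatAt f w : ℝ)) *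
                  (σ * t ^ (-σ - 1))) := by
                rw [Finset.sum_mul, ENNReal.ofReal_sum_of_nonneg fun w _ => by positivity]
            _ ≤ _ := by
                refine ENNReal.ofReal_le_ofReal ?_
                calc _ ≤ C * t ^ τ * (σ * t ^ (-σ - 1)) := by
                      gcongr
                      exact hn t ht.le
                  _ = _ := by
                      rw [show τ - σ - 1 = τ + (-σ - 1) by ring, rpow_add (by linarith)]
                      ring

/-! ### The difference quotient Δf / f -/

theorem rpow_sum_le_sum_rpow {ι : Type*} (s : Finset ι) (x : ι → ℝ) (hx : ∀ i ∈ s, 0 ≤ x i) {p : ℝ}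
    (hp : 0 < p) (hp1 : p ≤ 1) : (∑ i ∈ s, x i) ^ p ≤ ∑ i ∈ s, x i ^ p := by
  classical
  induction s using Finset.induction_on with
  | empty => simp [hp.ne']
  | insert i s hi ih =>
    rw [Finset.sum_insert hi, Finset.sum_insert hi]
    have h1 := fun j hj => hx j (Finset.mem_insert_of_mem hj)
    refine (Real.rpow_add_le_add_rpow (hx i (Finset.mem_insert_self i s))
      (Finset.sum_nonneg h1) hp.le hp1).trans ?_
    gcongr
    exact ih h1

theorem norm_prod_one_add_pow_sub_one_le (S : Finset ℂ) (x : ℂ → ℂ) (m : ℂ → ℕ) :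
    ‖∏ w ∈ S, (1 + x w) ^ m w - 1‖ ≤ Real.exp (∑ w ∈ S, m w * ‖x w‖) - 1 := by
  have h := (S.sigma fun w => Finset.range (m w)).norm_prod_one_add_sub_one_le fun i => x i.1
  rw [Finset.prod_sigma, Finset.sum_sigma] at h
  simpa using h

/-- If `∑ m_w / |z - w| ≤ B ≤ 1` over the zeros of `f`, then `|Δ f(z)| ≤ 2 B |f(z)|`. -/
theorem norm_sub_le_of_sum_le {f : ℂ → ℂ} (hf : Differentiable ℂ f)
    (h : growthOrder f < 1) {z : ℂ} (hz : f z ≠ 0) {B : ℝ} (hB1 : B ≤ 1)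
    (hB : ∀ n : ℕ, ∑ w ∈ zeroFinset f n, analyticOrderNatAt f w * ‖(z - w)⁻¹‖ ≤ B) :
    ‖f (z + 1) - f z‖ ≤ 2 * B * ‖f z‖ := by
  have h0 : f ≠ 0 := by rintro rfl; exact hz rfl
  have hlim := ((tendsto_prod_zeroFinset hf h hz (z + 1)).sub_const 1).norm
  have hle : ‖f (z + 1) / f z - 1‖ ≤ 2 * B := by
    refine le_of_tendsto' hlim fun n => ?_
    have he : ∏ w ∈ zeroFinset f n, ((z + 1 - w) / (z - w)) ^ analyticOrderNatAt f w =
        ∏ w ∈ zeroFinset f n, (1 + (z - w)⁻¹) ^ analyticOrderNatAt f w := by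
      refine Finset.prod_congr rfl fun w hw => ?_
      have : z - w ≠ 0 := sub_ne_zero.2 fun e => hz (e ▸ ((mem_zeroFinset hf h0).1 hw).2)
      congr 1
      field_simp
      ring
    rw [he]
    refine (norm_prod_one_add_pow_sub_one_le _ _ _).trans ?_
    set X := ∑ w ∈ zeroFinset f n, analyticOrderNatAt f w * ‖(z - w)⁻¹‖
    have hX0 : 0 ≤ X := by positivity
    -- This is exp X - 1 ≤ 2X for 0 ≤ X ≤ 1, the reason for `hB1` and for the factor 2.
    have := Real.abs_exp_sub_one_le (x := X) (by rw [abs_of_nonneg hX0]; exact (hB n).trans hB1)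
    rw [abs_of_nonneg hX0] at this
    linarith [le_abs_self (Real.exp X - 1), hB n]
  calc ‖f (z + 1) - f z‖ = ‖f (z + 1) / f z - 1‖ * ‖f z‖ := by
        rw [← norm_mul]
        congr 1
        field_simp
    _ ≤ _ := by gcongr

/-- A pointwise estimate of the difference quotient `Δ f / f` of an entire function of order less
than `1`, outside an exceptional set of radii. -/
theorem exists_exceptional_set {f : ℂ → ℂ} (hf : Differentiable ℂ f) (h0 : f ≠ 0) {γ : ℝ}
    (hγ : growthOrder f < γ) (hγ1 : γ < 1) :
    ∃ E, FiniteLogMeasure E ∧ ∀ z : ℂ, 1 < ‖z‖ → ‖z‖ ∉ E →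
      f z ≠ 0 ∧ ‖f (z + 1) - f z‖ ≤ 2 * ‖z‖ ^ (γ - 1) * ‖f z‖ := by
  have : Countable {w | f w = 0} := (countable_zeros hf h0).to_subtype
  obtain ⟨τ, hτ, hτγ⟩ := EReal.lt_iff_exists_real_btwn.1 hγ
  have hτ0 : 0 < τ := by exact_mod_cast (growthOrder_nonneg f).trans_lt hτ
  replace hτγ : τ < γ := by exact_mod_cast hτγ
  have hγ0 : 0 < γ := hτ0.trans hτγ
  -- α < 1 makes |t - |w||^(-α) locally integrable, while αγ > τ makes ∑ m(w) |w|^(-αγ) converge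
  -- over the nonzero zeros.
  obtain ⟨α, hα, hα1⟩ := exists_between ((div_lt_one hγ0).2 hτγ)
  rw [div_lt_iff₀ hγ0] at hα
  have hα0 : 0 < α := pos_of_mul_pos_left (hτ0.trans hα) hγ0.le
  obtain ⟨K, hK, hKs⟩ := exists_lintegral_abs_sub_rpow_le (σ := α * γ) hα1
    (mul_pos hα0 hγ0) (by nlinarith)
  set m := analyticOrderNatAt f
  set φ : ℝ → ℝ≥0∞ := fun r =>
    ∑' w : {w | f w = 0}, (m w : ℝ≥0∞) * ENNReal.ofReal |r - ‖(w : ℂ)‖| ^ (-α) with hφ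
  have hφm : Measurable φ := Measurable.tsum fun w => by fun_prop
  -- A Chebyshev argument: on this set 1/t ≤ φ(t) t^(α - αγ - 1), and the right side is integrated
  -- over t > 1 zero by zero.
  refine ⟨{r | 1 < r ∧ ENNReal.ofReal (r ^ (α * (γ - 1))) ≤ φ r}, ⟨fun r hr => hr.1, ?_, ?_⟩,
    fun z hz hzE => ?_⟩
  · exact measurableSet_Ioi.inter (measurableSet_le (by fun_prop) hφm)
  · calc _ ≤ ∫⁻ t in {r | 1 < r ∧ ENNReal.ofReal (r ^ (α * (γ - 1))) ≤ φ r},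
          φ t * ENNReal.ofReal (t ^ (α - α * γ - 1)) := by
          refine setLIntegral_mono' (measurableSet_Ioi.inter
            (measurableSet_le (by fun_prop) hφm)) fun t ht => ?_
          have ht0 : 0 < t := by linarith [ht.1]
          calc ENNReal.ofReal t⁻¹
              = ENNReal.ofReal (t ^ (α * (γ - 1))) * ENNReal.ofReal (t ^ (α - α * γ - 1)) := by
                rw [← ENNReal.ofReal_mul (by positivity), ← rpow_add ht0, ← rpow_neg_one]
                ring_nf
            _ ≤ _ := by
                gcongr
                exact ht.2
      _ ≤ ∫⁻ t in Ioi 1, φ t * ENNReal.ofReal (t ^ (α - α * γ - 1)) :=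
          lintegral_mono_set fun t ht => ht.1
      _ = ∑' w : {w | f w = 0}, (m w : ℝ≥0∞) * ∫⁻ t in Ioi 1,
            ENNReal.ofReal |t - ‖(w : ℂ)‖| ^ (-α) * ENNReal.ofReal (t ^ (α - α * γ - 1)) := by
          simp only [hφ, ← ENNReal.tsum_mul_right]
          rw [lintegral_tsum fun w => by fun_prop]
          refine tsum_congr fun w => ?_
          rw [← lintegral_const_mul _ (by fun_prop)]
          simp only [mul_assoc]
      _ ≤ ∑' w : {w | f w = 0}, K * ((m w : ℝ≥0∞) *
            ENNReal.ofReal (max 1 ‖(w : ℂ)‖ ^ (-(α * γ)))) := by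
          refine ENNReal.tsum_le_tsum fun w => ?_
          rw [mul_left_comm]
          gcongr
          exact hKs _ (norm_nonneg _)
      _ < ⊤ := by
          rw [ENNReal.tsum_mul_left]
          refine ENNReal.mul_lt_top hK (tsum_order_mul_rpow_lt_top hf h0 (hτ.trans ?_))
          exact_mod_cast hα
  · set r := ‖z‖
    have hr0 : 0 < r := by linarith
    have hφr : φ r < ENNReal.ofReal (r ^ (α * (γ - 1))) := by
      by_contra! h
      exact hzE ⟨hz, h⟩
    -- A zero on the circle makes φ(r) infinite, as 0^(-α) = ⊤ in `ℝ≥0∞`; such radii are therefore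
    -- already exceptional.
    have hne : ∀ w, f w = 0 → r ≠ ‖w‖ := fun w hw hrw => by
      have h1 := ENNReal.le_tsum (f := fun w : {w | f w = 0} =>
        (m w : ℝ≥0∞) * ENNReal.ofReal |r - ‖(w : ℂ)‖| ^ (-α)) ⟨w, hw⟩
      have h2 : (m w : ℝ≥0∞) * ENNReal.ofReal |r - ‖w‖| ^ (-α) = ⊤ := by
        rw [hrw, sub_self, abs_zero, ENNReal.ofReal_zero, ENNReal.zero_rpow_of_neg (by linarith)]
        refine ENNReal.mul_top ?_
        exact_mod_cast (orderNat_pos hf h0 hw).ne'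
      simp only [h2] at h1
      exact absurd (h1.trans_lt hφr) (by simp)
    have hfz : f z ≠ 0 := fun h => hne z h rfl
    refine ⟨hfz, norm_sub_le_of_sum_le hf (hγ.trans (by exact_mod_cast hγ1)) hfz
      (rpow_le_one_of_one_le_of_nonpos hz.le (by linarith)) fun n => ?_⟩
    set S := zeroFinset f n
    have hd : ∀ w ∈ S, 0 < |r - ‖w‖| := fun w hw =>
      abs_pos.2 (sub_ne_zero.2 (hne w ((mem_zeroFinset hf h0).1 hw).2))
    have h1 : ∑ w ∈ S, m w * |r - ‖w‖| ^ (-α) ≤ r ^ (α * (γ - 1)) := by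
      refine (ENNReal.ofReal_le_ofReal_iff (by positivity)).1 (le_trans (le_of_eq ?_)
        ((sum_zeroFinset_le_tsum hf h0 n
          fun w => (m w : ℝ≥0∞) * ENNReal.ofReal |r - ‖w‖| ^ (-α)).trans hφr.le))
      rw [ENNReal.ofReal_sum_of_nonneg fun w _ => by positivity]
      refine Finset.sum_congr rfl fun w hw => ?_
      rw [ENNReal.ofReal_mul (by positivity), ENNReal.ofReal_natCast,
        ENNReal.ofReal_rpow_of_pos (hd w hw)]
    -- Subadditivity of x^α, with m^α ≤ m and |z-w| ≥ |r-|w||, compares the sum with φ(r).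
    have h2 : (∑ w ∈ S, m w * ‖(z - w)⁻¹‖) ^ α ≤ (r ^ (γ - 1)) ^ α := by
      rw [← rpow_mul hr0.le, mul_comm (γ - 1)]
      refine ((rpow_sum_le_sum_rpow S _ (fun w _ => by positivity) hα0 hα1.le).trans
        (Finset.sum_le_sum fun w hw => ?_)).trans h1
      rw [mul_rpow (by positivity) (norm_nonneg _), norm_inv, inv_rpow (norm_nonneg _),
        ← rpow_neg (norm_nonneg _)]
      have hm : (1 : ℝ) ≤ m w := by
        exact_mod_cast orderNat_pos hf h0 ((mem_zeroFinset hf h0).1 hw).2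
      gcongr ?_ * ?_
      · exact (rpow_le_rpow_of_exponent_le hm hα1.le).trans (by rw [rpow_one])
      · exact rpow_le_rpow_of_nonpos (hd w hw) (abs_norm_sub_norm_le z w) (by linarith)
    exact (rpow_le_rpow_iff (by positivity) (by positivity) hα0).1 h2

/-! ### The shifting counting function as a sum over zeros -/

/-- The contribution of a point of modulus `s` to a logarithmic counting function at `r`; for
`s = 0` we use `log 0 = 0`. -/
noncomputable def logWeight (r s : ℝ) : ℝ := if s ≤ r then Real.log r - Real.log s else 0

theorem logWeight_of_le {r s : ℝ} (h : s ≤ r) : logWeight r s = Real.log r - Real.log s := if_pos h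

theorem log_le_log_of_nonneg_of_one_le {r s : ℝ} (hs : 0 ≤ s) (hr : 1 ≤ r) (h : s ≤ r) :
    Real.log s ≤ Real.log r := by
  rcases hs.eq_or_lt with rfl | hs
  · rw [Real.log_zero]; exact Real.log_nonneg hr
  · exact Real.log_le_log hs h

theorem logWeight_nonneg {r s : ℝ} (hs : 0 ≤ s) (hr : 1 ≤ r) : 0 ≤ logWeight r s := by
  unfold logWeight
  split_ifs with h
  · exact sub_nonneg.2 (log_le_log_of_nonneg_of_one_le hs hr h)
  · exact le_rfl

/-- The integrand in the logarithmic counting function of a point of modulus `s`. -/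
noncomputable def stepQuotient (s t : ℝ) : ℝ :=
  ((if s ≤ t then 1 else 0) - (if s ≤ 0 then 1 else 0)) / t

/-- For s > 0 the integrand is 1/t from s onwards and 0 before. For s = 0 the two indicators cancel
and the whole weight log r comes from the term outside the integral. -/
theorem integral_stepQuotient {r s : ℝ} (hs : 0 ≤ s) (hr : 0 < r) :
    IntervalIntegrable (stepQuotient s) volume 0 r ∧
      (∫ t in (0 : ℝ)..r, stepQuotient s t) + (if s ≤ 0 then 1 else 0) * Real.log r =
        logWeight r s := by
  rcases hs.eq_or_lt with rfl | hs
  · have h : EqOn (fun _ => (0 : ℝ)) (stepQuotient 0) (uIcc 0 r) := fun t ht => by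
      rw [uIcc_of_le hr.le] at ht
      simp [stepQuotient, ht.1]
    refine ⟨IntervalIntegrable.congr (h.mono uIoc_subset_uIcc) intervalIntegrable_const, ?_⟩
    rw [← intervalIntegral.integral_congr h]
    simp [logWeight, hr.le]
  · have hq : ∀ t, stepQuotient s t = if s ≤ t then t⁻¹ else 0 := fun t => by
      simp only [stepQuotient, hs.not_ge, if_false, sub_zero]
      split_ifs <;> simp
    have hzero : ∀ u, 0 ≤ u → u ≤ s → IntervalIntegrable (stepQuotient s) volume 0 u ∧
        ∫ t in (0 : ℝ)..u, stepQuotient s t = 0 := fun u hu hus => by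
      -- Equality holds only almost everywhere: for u = s the integrand jumps to 1/s at the
      -- endpoint.
      have h : (fun _ => (0 : ℝ)) =ᵐ[volume.restrict (uIoc 0 u)] stepQuotient s := by
        rw [uIoc_of_le hu, ← restrict_Ioo_eq_restrict_Ioc]
        filter_upwards [ae_restrict_mem measurableSet_Ioo] with t ht
        rw [hq, if_neg (by linarith [ht.2])]
      refine ⟨intervalIntegrable_const.congr_ae h, ?_⟩
      rw [← intervalIntegral.integral_congr_ae_restrict h, intervalIntegral.integral_zero]
    simp only [hs.not_ge, if_false, zero_mul, add_zero]
    rcases lt_or_ge r s with hrs | hrs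
    · rw [logWeight, if_neg hrs.not_ge]
      exact hzero r hr.le hrs.le
    · have h : EqOn (fun t : ℝ => t⁻¹) (stepQuotient s) (uIcc s r) := fun t ht => by
        rw [uIcc_of_le hrs] at ht
        rw [hq, if_pos ht.1]
      have hi : IntervalIntegrable (fun t : ℝ => t⁻¹) volume s r := by
        refine intervalIntegral.intervalIntegrable_inv (fun t ht => ?_) continuousOn_id
        rw [uIcc_of_le hrs] at ht
        exact (hs.trans_le ht.1).ne'
      have hi' : IntervalIntegrable (stepQuotient s) volume s r :=
        IntervalIntegrable.congr (h.mono uIoc_subset_uIcc) hi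
      obtain ⟨hz, hz0⟩ := hzero s hs.le le_rfl
      refine ⟨hz.trans hi', ?_⟩
      rw [← intervalIntegral.integral_add_adjacent_intervals hz hi', hz0, zero_add,
        ← intervalIntegral.integral_congr h, integral_inv_of_pos hs hr, logWeight_of_le hrs,
        Real.log_div hr.ne' hs.ne']

/-- A point w of the disc is an initial shifting zero m(w) - m(w-1) times, with truncated
subtraction, that is m(w) - min(m(w), m(w-1)); the minimum is lost only if w-1 also lies in the
disc, whence the maximum of the two moduli. A set S independent of t allows integration term by
term. -/
theorem nBarDelta_eq {f : ℂ → ℂ} (hf : Differentiable ℂ f) (h0 : f ≠ 0) {R t : ℝ} {S : Finset ℂ}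
    (hS : ∀ w, ‖w‖ ≤ R → f w = 0 → w ∈ S) (ht : t ≤ R) :
    (nBarDelta t f : ℝ) =
      (∑ w ∈ S, (analyticOrderNatAt f w : ℝ) * if ‖w‖ ≤ t then 1 else 0) -
      ∑ w ∈ S, (min (analyticOrderNatAt f w) (analyticOrderNatAt f (w - 1)) : ℕ) *
        if max ‖w‖ ‖w - 1‖ ≤ t then (1 : ℝ) else 0 := by
  classical
  have hspec := initialShiftingZeros_spec t hf h0
  have hcount := fun w => hspec.count_eq hf h0 w
  have hsub : ∀ w ∈ initialShiftingZeros t f, w ∈ S := fun w hw => by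
    have h1 := Multiset.count_pos.2 hw
    rw [hcount] at h1
    have hwt : w ∈ closedBall (0 : ℂ) t := by
      by_contra h
      simp [h] at h1
    rw [if_pos hwt] at h1
    refine hS w ((by simpa using hwt : ‖w‖ ≤ t).trans ht) ?_
    by_contra h
    rw [(orderNat_eq_zero_iff hf h0 w).2 h] at h1
    omega
  rw [nBarDelta, ← Multiset.sum_count_eq_card hsub, ← Finset.sum_sub_distrib, Nat.cast_sum]
  refine Finset.sum_congr rfl fun w _ => ?_
  rw [hcount]
  simp only [mem_closedBall, dist_zero_right, max_le_iff]
  by_cases h1 : ‖w‖ ≤ t <;> by_cases h2 : ‖w - 1‖ ≤ t <;> simp only [h1, h2, if_true, if_false,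
    and_self, and_true, and_false, mul_one, mul_zero, sub_zero, Nat.cast_zero,
    Nat.sub_zero]
  rw [eq_sub_iff_add_eq, ← Nat.cast_add]
  congr 1
  omega

theorem NBarDelta_eq {f : ℂ → ℂ} (hf : Differentiable ℂ f) (h0 : f ≠ 0) {R : ℝ} {S : Finset ℂ}
    (hS : ∀ w, ‖w‖ ≤ R → f w = 0 → w ∈ S) (hR : 0 < R) :
    NBarDelta R f = (∑ w ∈ S, (analyticOrderNatAt f w : ℝ) * logWeight R ‖w‖) -
      ∑ w ∈ S, (min (analyticOrderNatAt f w) (analyticOrderNatAt f (w - 1)) : ℕ) *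
        logWeight R (max ‖w‖ ‖w - 1‖) := by
  set m : ℂ → ℝ := fun w => analyticOrderNatAt f w
  set μ : ℂ → ℝ := fun w => (min (analyticOrderNatAt f w) (analyticOrderNatAt f (w - 1)) : ℕ)
  have h1 : EqOn (fun t => ((nBarDelta t f : ℝ) - (nBarDelta 0 f : ℝ)) / t)
      (fun t => (∑ w ∈ S, m w * stepQuotient ‖w‖ t) -
        ∑ w ∈ S, μ w * stepQuotient (max ‖w‖ ‖w - 1‖) t) (uIcc 0 R) := fun t ht => by
    rw [uIcc_of_le hR.le] at ht
    simp only [nBarDelta_eq hf h0 hS ht.2, nBarDelta_eq hf h0 hS hR.le, stepQuotient]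
    simp only [← mul_div_assoc, ← Finset.sum_div, mul_sub, Finset.sum_sub_distrib, m, μ]
    ring
  have hm : ∀ w : ℂ, 0 ≤ max ‖w‖ ‖w - 1‖ := fun w => (norm_nonneg w).trans (le_max_left _ _)
  have i1 : ∀ w ∈ S, IntervalIntegrable (fun t => m w * stepQuotient ‖w‖ t) volume 0 R :=
    fun w _ => (integral_stepQuotient (norm_nonneg w) hR).1.const_mul _
  have i2 : ∀ w ∈ S, IntervalIntegrable (fun t => μ w * stepQuotient (max ‖w‖ ‖w - 1‖) t)
      volume 0 R := fun w _ => (integral_stepQuotient (hm w) hR).1.const_mul _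
  have j1 := IntervalIntegrable.sum S i1
  have j2 := IntervalIntegrable.sum S i2
  rw [Finset.sum_fn] at j1 j2
  rw [NBarDelta, intervalIntegral.integral_congr h1, intervalIntegral.integral_sub j1 j2,
    intervalIntegral.integral_finsetSum i1, intervalIntegral.integral_finsetSum i2,
    nBarDelta_eq hf h0 hS hR.le]
  simp only [intervalIntegral.integral_const_mul]
  rw [← Finset.sum_congr rfl fun w _ => congrArg (m w * ·)
    (integral_stepQuotient (norm_nonneg w) hR).2, ← Finset.sum_congr rfl fun w _ => congrArg (μ w * ·)
    (integral_stepQuotient (hm w) hR).2]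
  simp only [mul_add, Finset.sum_add_distrib, sub_mul, Finset.sum_mul, mul_assoc, m, μ]
  ring

/-! ### Relative shifting primality in terms of zeros -/

/-- Zeros at all z + n would give at least N zeros in the disc of radius |z| + N, against the bound
O(r^τ) with τ < 1. Hence every zero has a finite length. -/
theorem exists_add_natCast_ne_zero {f : ℂ → ℂ} (hf : Differentiable ℂ f) (h0 : f ≠ 0)
    (h : growthOrder f < 1) (z : ℂ) : ∃ n : ℕ, f (z + n) ≠ 0 := by
  classical
  by_contra! hcon
  obtain ⟨τ, hτ, hτ1⟩ := EReal.lt_iff_exists_real_btwn.1 h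
  replace hτ1 : τ < 1 := by exact_mod_cast hτ1
  obtain ⟨C, hC, hn⟩ := exists_sum_order_le hf h0 hτ
  have hcard : ∀ N : ℕ, (N : ℝ) ≤ ∑ w ∈ zeroFinset f (‖z‖ + N), (analyticOrderNatAt f w : ℝ) := by
    intro N
    have hsub : (Finset.range N).image (fun j : ℕ => z + j) ⊆ zeroFinset f (‖z‖ + N) := by
      intro w hw
      obtain ⟨j, hj, rfl⟩ := Finset.mem_image.1 hw
      refine (mem_zeroFinset hf h0).2 ⟨(norm_add_le _ _).trans ?_, hcon j⟩
      have : (j : ℝ) ≤ N := by exact_mod_cast (Finset.mem_range.1 hj).le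
      simpa using this
    have h1 : ((Finset.range N).image (fun j : ℕ => z + j)).card = N := by
      rw [Finset.card_image_of_injective _ fun i j hij => by simpa using hij, Finset.card_range]
    calc (N : ℝ) = ∑ w ∈ (Finset.range N).image (fun j : ℕ => z + j), (1 : ℝ) := by
          rw [Finset.sum_const, h1]; simp
      _ ≤ ∑ w ∈ zeroFinset f (‖z‖ + N), (1 : ℝ) :=
          Finset.sum_le_sum_of_subset_of_nonneg hsub fun _ _ _ => zero_le_one
      _ ≤ _ := Finset.sum_le_sum fun w hw => by
          exact_mod_cast orderNat_pos hf h0 ((mem_zeroFinset hf h0).1 hw).2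
  have ht : Tendsto (fun N : ℕ => ‖z‖ + (N : ℝ)) atTop atTop :=
    tendsto_atTop_add_const_left _ _ tendsto_natCast_atTop_atTop
  have hlim := ((tendsto_rpow_neg_atTop (by linarith : 0 < 1 - τ)).const_mul C).comp ht
  rw [mul_zero] at hlim
  obtain ⟨N, hN1, hN2, hN3⟩ := ((hlim.eventually (gt_mem_nhds (by norm_num : (0 : ℝ) < 1 / 2))).and
    ((ht.eventually (eventually_ge_atTop 1)).and
      (ht.eventually (eventually_ge_atTop (2 * ‖z‖))))).exists
  set r := ‖z‖ + (N : ℝ) with hr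
  have hr0 : 0 < r := by linarith
  have h1 := (hcard N).trans (hn r hN2)
  simp only [Function.comp_apply, ← hr] at hN1
  rw [neg_sub, rpow_sub_one hr0.ne', ← mul_div_assoc, div_lt_iff₀ hr0] at hN1
  linarith

theorem exists_isZeroOfLength {f : ℂ → ℂ} {z : ℂ} (hz : f z = 0) (h : ∃ n : ℕ, f (z + n) ≠ 0) :
    ∃ n, IsZeroOfLength f z n := by
  classical
  have hspec := Nat.find_spec h
  have hmin : ∀ j < Nat.find h, f (z + j) = 0 := fun j hj => not_not.1 (Nat.find_min h hj)
  refine ⟨Nat.find h, ?_, iter_fwdDiff_vanish_iff.2 hmin, ?_⟩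
  · by_contra hn
    rw [show Nat.find h = 0 by omega] at hspec
    simp [hz] at hspec
  · rwa [iter_fwdDiff_of_vanish hmin]

theorem hasCommonShiftingDivisor_symm {f g : ℂ → ℂ} (h : HasCommonShiftingDivisor f g) :
    HasCommonShiftingDivisor g f := by
  obtain ⟨z₁, z₂, z₀, m, n, m₁, n₁, F, G, h1, h2, h3, h4, h5, h6, h7, h8, h9, h10, h11, h12⟩ := h
  refine ⟨z₂, z₁, z₀, n, m, n₁, m₁, G, F, h2, h1, h5, h6, h3, h4, h8, h7, h10, h9, h11.symm,
    fun z => ?_⟩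
  rw [mul_comm, h12, add_comm m₁, mul_comm (F z)]

/-- If `f` and `g` are relatively shifting prime and of order less than `1`, a zero of `f` is never
followed by a zero of `g`. -/
theorem RelativelyShiftingPrime.ne_zero {f g : ℂ → ℂ} (hfg : RelativelyShiftingPrime f g)
    (hf : Differentiable ℂ f) (hg : Differentiable ℂ g) (hf0 : f ≠ 0) (hg0 : g ≠ 0)
    (hρf : growthOrder f < 1) (hρg : growthOrder g < 1) {z : ℂ} (hz : f z = 0) :
    g (z + 1) ≠ 0 := by
  intro hgz
  obtain ⟨m, hm⟩ := exists_isZeroOfLength hz (exists_add_natCast_ne_zero hf hf0 hρf z)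
  obtain ⟨n, hn⟩ := exists_isZeroOfLength hgz (exists_add_natCast_ne_zero hg hg0 hρg (z + 1))
  obtain ⟨F, hF, hfF⟩ := exists_factor (n := 1) (z := z) hf (by simpa using hz)
  obtain ⟨G, hG, hgG⟩ := exists_factor (n := 1) (z := z + 1) hg (by simpa using hgz)
  -- The factors w - z and w - (z+1), each of length 1, join to the falling factorial of length 2
  -- starting at z.
  refine hfg ⟨z, z + 1, z, m, n, 1, 1, F, G, hm, hn, le_rfl, hm.1, le_rfl, hn.1, hF, hG, hfF, hgG,
    Or.inl rfl, fun w => ?_⟩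
  have h1 : ∀ x, fallingFactorial 1 x = x := fun x => by simp [fallingFactorial]
  have h2 : ∀ x, fallingFactorial (1 + 1) x = x * (x - 1) := fun x => by
    rw [fallingFactorial_succ, h1, Nat.cast_one]
  rw [hfF, hgG, h1, h1, h2]
  ring

theorem RelativelyShiftingPrime.symm {f g : ℂ → ℂ} (h : RelativelyShiftingPrime f g) :
    RelativelyShiftingPrime g f := fun h' => h (hasCommonShiftingDivisor_symm h')

/-- In terms of orders: `f` has no zero at `w - 1` or `g` has no zero at `w`. -/
theorem RelativelyShiftingPrime.orderNat_eq_zero {f g : ℂ → ℂ} (hfg : RelativelyShiftingPrime f g)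
    (hf : Differentiable ℂ f) (hg : Differentiable ℂ g) (hf0 : f ≠ 0) (hg0 : g ≠ 0)
    (hρf : growthOrder f < 1) (hρg : growthOrder g < 1) (w : ℂ) :
    analyticOrderNatAt f (w - 1) = 0 ∨ analyticOrderNatAt g w = 0 := by
  rw [orderNat_eq_zero_iff hf hf0, orderNat_eq_zero_iff hg hg0]
  by_contra! h
  have := hfg.ne_zero hf hg hf0 hg0 hρf hρg h.1
  rw [sub_add_cancel] at this
  exact this h.2

theorem le_orderNat_of_eq_pow_mul {f g : ℂ → ℂ} (hf : Differentiable ℂ f) (h0 : f ≠ 0)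
    (hg : Differentiable ℂ g) {v : ℂ} {k : ℕ} (h : ∀ z, f z = (z - v) ^ k * g z) :
    k ≤ analyticOrderNatAt f v := by
  have : (k : ℕ∞) ≤ analyticOrderAt f v :=
    (natCast_le_analyticOrderAt (hf.analyticAt v)).2
      ⟨g, hg.analyticAt v, Eventually.of_forall fun z => by rw [h, smul_eq_mul]⟩
  rw [← Nat.cast_analyticOrderNatAt (order_ne_top hf h0 v)] at this
  exact_mod_cast this

theorem exists_eq_pow_mul_of_le {f : ℂ → ℂ} (hf : Differentiable ℂ f) (h0 : f ≠ 0) {v : ℂ} {k : ℕ}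
    (hk : k ≤ analyticOrderNatAt f v) :
    ∃ g, Differentiable ℂ g ∧ ∀ z, f z = (z - v) ^ k * g z := by
  obtain ⟨g, hg, hfg, -⟩ := exists_eq_pow_orderNat_mul v _ hf h0 rfl
  refine ⟨fun z => (z - v) ^ (analyticOrderNatAt f v - k) * g z, by fun_prop, fun z => ?_⟩
  rw [hfg z, ← mul_assoc, ← pow_add, Nat.add_sub_cancel' hk]

/-- Near w-1 both f(z) and f(z+1) are divisible by the power of z - (w-1) given by the minimum,
hence so is W. -/
theorem min_orderNat_le {f W p q : ℂ → ℂ} (hf : Differentiable ℂ f) (h0 : f ≠ 0)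
    (hW : Differentiable ℂ W) (hW0 : W ≠ 0) (hp : Differentiable ℂ p) (hq : Differentiable ℂ q)
    (h : ∀ z, W z = f z * p z + f (z + 1) * q z) (w : ℂ) :
    min (analyticOrderNatAt f w) (analyticOrderNatAt f (w - 1)) ≤ analyticOrderNatAt W (w - 1) := by
  obtain ⟨F, hF, hfF⟩ := exists_eq_pow_mul_of_le hf h0 (min_le_left (analyticOrderNatAt f w)
    (analyticOrderNatAt f (w - 1)))
  obtain ⟨G, hG, hfG⟩ := exists_eq_pow_mul_of_le hf h0 (min_le_right (analyticOrderNatAt f w)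
    (analyticOrderNatAt f (w - 1)))
  refine le_orderNat_of_eq_pow_mul hW hW0 (g := fun z => G z * p z + F (z + 1) * q z)
    (by fun_prop) fun z => ?_
  rw [h, hfG z, hfF (z + 1), show z + 1 - w = z - (w - 1) by ring]
  ring

/-! ### The Casoratian and its vanishing -/

/-- The difference analogue `f(z) g(z + 1) - g(z) f(z + 1)` of the Wronskian. -/
def casoratian (f g : ℂ → ℂ) (z : ℂ) : ℂ := f z * g (z + 1) - g z * f (z + 1)

theorem differentiable_casoratian {f g : ℂ → ℂ} (hf : Differentiable ℂ f)
    (hg : Differentiable ℂ g) : Differentiable ℂ (casoratian f g) := by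
  unfold casoratian
  fun_prop

/-- f and g turn out to have the same zeros with the same multiplicities; for order less than 1 the
product representation then determines them up to a constant factor. -/
theorem casoratian_eq_zero_proportional {f g : ℂ → ℂ} (hf : Differentiable ℂ f)
    (hg : Differentiable ℂ g) (hf0 : f ≠ 0) (hg0 : g ≠ 0)
    (hρf : growthOrder f < 1) (hρg : growthOrder g < 1) (hfg : RelativelyShiftingPrime f g)
    (h : casoratian f g = 0) : ∃ k : ℂ, k ≠ 0 ∧ g = k • f := by
  have hW : ∀ z, f z * g (z + 1) = g z * f (z + 1) := fun z => sub_eq_zero.1 (congrFun h z)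
  have key : ∀ {f g : ℂ → ℂ}, Differentiable ℂ f → Differentiable ℂ g → f ≠ 0 → g ≠ 0 →
      growthOrder f < 1 → growthOrder g < 1 → RelativelyShiftingPrime f g →
      (∀ z, f z * g (z + 1) = g z * f (z + 1)) → ∀ z, f z = 0 → g z = 0 := by
    intro f g hf hg hf0 hg0 hρf hρg hfg hW z hz
    by_contra hgz
    obtain ⟨n, hn⟩ := exists_add_natCast_ne_zero hf hf0 hρf z
    -- The identity f(z) g(z+1) = g(z) f(z+1) moves the zero of f one step right, and primality
    -- keeps g nonzero there, so f would vanish at every z + n.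
    have : ∀ n : ℕ, f (z + n) = 0 ∧ g (z + n) ≠ 0 := by
      intro n
      induction n with
      | zero => simpa using ⟨hz, hgz⟩
      | succ n ih =>
        have h1 := hW (z + n)
        rw [ih.1, zero_mul] at h1
        rw [Nat.cast_succ, ← add_assoc]
        exact ⟨(mul_eq_zero.1 h1.symm).resolve_left ih.2,
          hfg.ne_zero hf hg hf0 hg0 hρf hρg ih.1⟩
    exact hn (this n).1
  have hiff : ∀ z, f z = 0 ↔ g z = 0 := fun z =>
    ⟨key hf hg hf0 hg0 hρf hρg hfg hW z,
      key hg hf hg0 hf0 hρg hρf hfg.symm (fun z => (hW z).symm) z⟩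
  have hd : ∀ {f : ℂ → ℂ}, Differentiable ℂ f → Differentiable ℂ fun z => f (z + 1) :=
    fun hf => hf.comp (differentiable_id.add_const 1)
  have hsh : ∀ {f : ℂ → ℂ}, f ≠ 0 → (fun z => f (z + 1)) ≠ 0 := fun {f} hf0 h => hf0 (by
    funext z
    simpa using congrFun h (z - 1))
  -- At a common zero w neither f nor g vanishes at w+1, so the two sides of the identity have at w
  -- the orders of f and of g.
  have hord : ∀ w, analyticOrderNatAt f w = analyticOrderNatAt g w := fun w => by
    by_cases hw : f w = 0
    · have h1 := orderNat_mul hf (hd hg) hf0 (hsh hg0) w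
      have h2 := orderNat_mul hg (hd hf) hg0 (hsh hf0) w
      rw [(orderNat_eq_zero_iff (hd hg) (hsh hg0) w).2
        (hfg.ne_zero hf hg hf0 hg0 hρf hρg hw), add_zero] at h1
      rw [(orderNat_eq_zero_iff (hd hf) (hsh hf0) w).2
        (hfg.symm.ne_zero hg hf hg0 hf0 hρg hρf ((hiff w).1 hw)), add_zero] at h2
      rw [← h1, ← h2]
      congr 1
      exact funext hW
    · rw [(orderNat_eq_zero_iff hf hf0 w).2 hw,
        (orderNat_eq_zero_iff hg hg0 w).2 fun h => hw ((hiff w).2 h)]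
  have hzf : ∀ r, zeroFinset f r = zeroFinset g r := fun r => by
    ext w
    rw [mem_zeroFinset hf hf0, mem_zeroFinset hg hg0, hiff]
  obtain ⟨p, hp⟩ : ∃ p, f p ≠ 0 := by
    by_contra! h
    exact hf0 (funext h)
  have hgp : g p ≠ 0 := fun h => hp ((hiff p).2 h)
  refine ⟨g p / f p, div_ne_zero hgp hp, funext fun z => ?_⟩
  have h1 := tendsto_prod_zeroFinset hf hρf hp z
  have h2 := tendsto_prod_zeroFinset hg hρg hgp z
  simp only [hzf, hord] at h1
  have h3 := tendsto_nhds_unique h1 h2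
  simp only [Pi.smul_apply, smul_eq_mul]
  field_simp at h3 ⊢
  linear_combination -h3

/-- A nonconstant entire function of order less than `1` has a zero. -/
theorem exists_zero_of_not_constant {f : ℂ → ℂ} (hf : Differentiable ℂ f) (hρ : growthOrder f < 1)
    (h : ¬ ∃ k, ∀ z, f z = k) : ∃ z, f z = 0 := by
  by_contra! hne
  have h0 : f ≠ 0 := fun h => hne 0 (congrFun h 0)
  refine h ⟨f 0, fun z => ?_⟩
  have h1 := tendsto_prod_zeroFinset hf hρ (hne 0) z
  have h2 : ∀ r, zeroFinset f r = ∅ := fun r =>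
    Finset.eq_empty_of_forall_notMem fun w hw => hne w ((mem_zeroFinset hf h0).1 hw).2
  simp only [h2, Finset.prod_empty] at h1
  have h3 := tendsto_nhds_unique h1 tendsto_const_nhds
  rwa [div_eq_one_iff_eq (hne 0)] at h3

/-! ### Comparing counting functions -/

/-- The convention log 0 = 0 could break monotonicity only at w = 1, where the maximum is 1 and both
logarithms are 0. -/
theorem logWeight_le_logWeight_sub_one {R : ℝ} {w : ℂ} (h : max ‖w‖ ‖w - 1‖ ≤ R) :
    logWeight R (max ‖w‖ ‖w - 1‖) ≤ logWeight R ‖w - 1‖ := by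
  rw [logWeight_of_le h, logWeight_of_le ((le_max_right _ _).trans h)]
  rcases (norm_nonneg (w - 1)).eq_or_lt with h0 | h0
  · have : w = 1 := by simpa [sub_eq_zero] using h0.symm
    simp [this]
  · have := Real.log_le_log h0 (le_max_right ‖w‖ ‖w - 1‖)
    linarith

/-- Multiplicities add. The minima also add: if one of the functions vanishes at w-1, primality
makes the other two nonzero at w, so mixed pairs never contribute. -/
theorem NBarDelta_mul_mul {a b c : ℂ → ℂ}
    (ha : Differentiable ℂ a) (hb : Differentiable ℂ b) (hc : Differentiable ℂ c)
    (ha0 : a ≠ 0) (hb0 : b ≠ 0) (hc0 : c ≠ 0)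
    (hρa : growthOrder a < 1) (hρb : growthOrder b < 1) (hρc : growthOrder c < 1)
    (hab : RelativelyShiftingPrime a b) (hac : RelativelyShiftingPrime a c)
    (hbc : RelativelyShiftingPrime b c) {R : ℝ} (hR : 0 < R) :
    NBarDelta R (a * b * c) = NBarDelta R a + NBarDelta R b + NBarDelta R c := by
  have hab0 := entire_mul_ne_zero ha hb ha0 hb0
  have h0 := entire_mul_ne_zero (ha.mul hb) hc hab0 hc0
  have hd := (ha.mul hb).mul hc
  set S := zeroFinset (a * b * c) R
  have hS : ∀ w, ‖w‖ ≤ R → (a * b * c) w = 0 → w ∈ S := fun w h1 h2 =>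
    (mem_zeroFinset hd h0).2 ⟨h1, h2⟩
  rw [NBarDelta_eq hd h0 hS hR,
    NBarDelta_eq ha ha0 (S := S) (fun w h1 h2 => hS w h1 (by simp [h2])) hR,
    NBarDelta_eq hb hb0 (S := S) (fun w h1 h2 => hS w h1 (by simp [h2])) hR,
    NBarDelta_eq hc hc0 (S := S) (fun w h1 h2 => hS w h1 (by simp [h2])) hR]
  have hm : ∀ w, analyticOrderNatAt (a * b * c) w =
      analyticOrderNatAt a w + analyticOrderNatAt b w + analyticOrderNatAt c w := fun w => by
    rw [orderNat_mul (ha.mul hb) hc hab0 hc0, orderNat_mul ha hb ha0 hb0]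
  have hμ : ∀ w, min (analyticOrderNatAt (a * b * c) w) (analyticOrderNatAt (a * b * c) (w - 1)) =
      min (analyticOrderNatAt a w) (analyticOrderNatAt a (w - 1)) +
      min (analyticOrderNatAt b w) (analyticOrderNatAt b (w - 1)) +
      min (analyticOrderNatAt c w) (analyticOrderNatAt c (w - 1)) := fun w => by
    rw [hm, hm]
    have h1 := hab.orderNat_eq_zero ha hb ha0 hb0 hρa hρb w
    have h2 := hac.orderNat_eq_zero ha hc ha0 hc0 hρa hρc w
    have h3 := hbc.orderNat_eq_zero hb hc hb0 hc0 hρb hρc w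
    have h4 := hab.symm.orderNat_eq_zero hb ha hb0 ha0 hρb hρa w
    have h5 := hac.symm.orderNat_eq_zero hc ha hc0 ha0 hρc hρa w
    have h6 := hbc.symm.orderNat_eq_zero hc hb hc0 hb0 hρc hρb w
    omega
  simp only [hμ]
  simp only [hm, Nat.cast_add, add_mul, Finset.sum_add_distrib]
  ring

/-- If the multiplicities that are lost in `NBarDelta` are zeros of `W`, the loss is controlled by
the counting function of the zeros of `W`. -/
theorem le_NBarDelta_add {f W : ℂ → ℂ} (hf : Differentiable ℂ f) (h0 : f ≠ 0)
    (hW : Differentiable ℂ W) (hW0 : W ≠ 0)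
    (h : ∀ w, min (analyticOrderNatAt f w) (analyticOrderNatAt f (w - 1)) ≤
      analyticOrderNatAt W (w - 1)) {R : ℝ} (hR : 1 ≤ R) :
    circleAverage (fun z => Real.log ‖f z‖) 0 R - Real.log ‖meromorphicTrailingCoeffAt f 0‖ ≤
      NBarDelta R f + (circleAverage (fun z => Real.log ‖W z‖) 0 R -
        Real.log ‖meromorphicTrailingCoeffAt W 0‖) := by
  classical
  have hR0 : 0 < R := by linarith
  rw [NBarDelta_eq hf h0 (S := zeroFinset f R)
    (fun w h1 h2 => (mem_zeroFinset hf h0).2 ⟨h1, h2⟩) hR0,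
    circleAverage_log_norm_eq hf h0 hR0, circleAverage_log_norm_eq hW hW0 hR0,
    add_sub_cancel_right, add_sub_cancel_right]
  have hconv : ∀ {g : ℂ → ℂ}, Differentiable ℂ g → g ≠ 0 →
      ∑ w ∈ zeroFinset g R, (analyticOrderNatAt g w : ℝ) * (Real.log R - Real.log ‖w‖) =
      ∑ w ∈ zeroFinset g R, (analyticOrderNatAt g w : ℝ) * logWeight R ‖w‖ := fun hg hg0 =>
    Finset.sum_congr rfl fun w hw => by rw [logWeight_of_le ((mem_zeroFinset hg hg0).1 hw).1]
  rw [hconv hf h0, hconv hW hW0]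
  have hnn : ∀ w, 0 ≤ (analyticOrderNatAt W w : ℝ) * logWeight R ‖w‖ := fun w =>
    mul_nonneg (by positivity) (logWeight_nonneg (norm_nonneg _) hR)
  suffices hsuff : ∑ w ∈ zeroFinset f R,
      ((min (analyticOrderNatAt f w) (analyticOrderNatAt f (w - 1)) : ℕ) : ℝ) *
        logWeight R (max ‖w‖ ‖w - 1‖) ≤
      ∑ w ∈ zeroFinset W R, (analyticOrderNatAt W w : ℝ) * logWeight R ‖w‖ by linarith
  -- The loss at w is charged to the zero w-1 of W; the shift is injective, so no zero of W is
  -- charged twice.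
  set T := (zeroFinset f R).filter fun w => w - 1 ∈ zeroFinset W R
  calc _ ≤ ∑ w ∈ zeroFinset f R, if w - 1 ∈ zeroFinset W R then
        (analyticOrderNatAt W (w - 1) : ℝ) * logWeight R ‖w - 1‖ else 0 := by
        refine Finset.sum_le_sum fun w _ => ?_
        rcases Nat.eq_zero_or_pos (min (analyticOrderNatAt f w) (analyticOrderNatAt f (w - 1)))
          with hm | hm
        · rw [hm, Nat.cast_zero, zero_mul]
          split_ifs
          · exact hnn _
          · exact le_rfl
        by_cases hw : max ‖w‖ ‖w - 1‖ ≤ R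
        · have hmem : w - 1 ∈ zeroFinset W R := by
            refine (mem_zeroFinset hW hW0).2 ⟨(le_max_right _ _).trans hw, ?_⟩
            by_contra hne
            have := h w
            rw [(orderNat_eq_zero_iff hW hW0 _).2 hne] at this
            omega
          rw [if_pos hmem]
          refine mul_le_mul (by exact_mod_cast h w) (logWeight_le_logWeight_sub_one hw)
            (logWeight_nonneg ((norm_nonneg w).trans (le_max_left _ _)) hR) (by positivity)
        · rw [logWeight, if_neg hw, mul_zero]
          split_ifs
          · exact hnn _
          · exact le_rfl
    _ = ∑ w ∈ T, (analyticOrderNatAt W (w - 1) : ℝ) * logWeight R ‖w - 1‖ := by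
        rw [Finset.sum_filter]
    _ = ∑ v ∈ T.image (fun w => w - 1), (analyticOrderNatAt W v : ℝ) * logWeight R ‖v‖ := by
        rw [Finset.sum_image fun x _ y _ hxy => by simpa using hxy]
    _ ≤ _ := by
        refine Finset.sum_le_sum_of_subset_of_nonneg (fun v hv => ?_) fun v _ _ => hnn v
        obtain ⟨w, hw, rfl⟩ := Finset.mem_image.1 hv
        exact (Finset.mem_filter.1 hw).2

/-- By primality the minimum for abc is that of a single factor, and W is a combination of f(z) and
f(z+1) for f = a, b and, because c = a + b, also for f = c. -/
theorem min_orderNat_mul_mul_le {a b c : ℂ → ℂ}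
    (ha : Differentiable ℂ a) (hb : Differentiable ℂ b) (hc : Differentiable ℂ c)
    (ha0 : a ≠ 0) (hb0 : b ≠ 0) (hc0 : c ≠ 0)
    (hρa : growthOrder a < 1) (hρb : growthOrder b < 1) (hρc : growthOrder c < 1)
    (hab : RelativelyShiftingPrime a b) (hac : RelativelyShiftingPrime a c)
    (hbc : RelativelyShiftingPrime b c) (habc : a + b = c) (hW0 : casoratian a b ≠ 0) (w : ℂ) :
    min (analyticOrderNatAt (a * b * c) w) (analyticOrderNatAt (a * b * c) (w - 1)) ≤
      analyticOrderNatAt (casoratian a b) (w - 1) := by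
  have hab0 := entire_mul_ne_zero ha hb ha0 hb0
  have hW := differentiable_casoratian ha hb
  have hm : ∀ w, analyticOrderNatAt (a * b * c) w =
      analyticOrderNatAt a w + analyticOrderNatAt b w + analyticOrderNatAt c w := fun w => by
    rw [orderNat_mul (ha.mul hb) hc hab0 hc0, orderNat_mul ha hb ha0 hb0]
  have hcz : ∀ z, c z = a z + b z := fun z => (congrFun habc z).symm
  have w1 := min_orderNat_le ha ha0 hW hW0 (p := fun z => b (z + 1)) (q := fun z => -b z)
    (by fun_prop) (by fun_prop) (fun z => by unfold casoratian; ring) w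
  have w2 := min_orderNat_le hb hb0 hW hW0 (p := fun z => -a (z + 1)) (q := a)
    (by fun_prop) (by fun_prop) (fun z => by unfold casoratian; ring) w
  have w3 := min_orderNat_le hc hc0 hW hW0 (p := fun z => b (z + 1)) (q := fun z => -b z)
    (by fun_prop) (by fun_prop) (fun z => by rw [hcz, hcz]; unfold casoratian; ring) w
  rw [hm, hm]
  have h1 := hab.orderNat_eq_zero ha hb ha0 hb0 hρa hρb w
  have h2 := hac.orderNat_eq_zero ha hc ha0 hc0 hρa hρc w
  have h3 := hbc.orderNat_eq_zero hb hc hb0 hc0 hρb hρc w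
  have h4 := hab.symm.orderNat_eq_zero hb ha hb0 ha0 hρb hρa w
  have h5 := hac.symm.orderNat_eq_zero hc ha hc0 ha0 hρc hρa w
  have h6 := hbc.symm.orderNat_eq_zero hc hb hc0 hb0 hρc hρb w
  omega

/-! ### The inequality for a nonzero Casoratian -/

/-- W is expressed through the two functions other than the one attaining the maximum; W = f Δg - g
Δf for such a pair bounds it by 2B |f| |g|, and the maximum supplies the third factor. Common zeros
of a, b, c do no harm. -/
theorem maxNorm_mul_norm_casoratian_le {a b c : ℂ → ℂ} (habc : a + b = c) {z : ℂ} {B : ℝ}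
    (ha : ‖a (z + 1) - a z‖ ≤ B * ‖a z‖) (hb : ‖b (z + 1) - b z‖ ≤ B * ‖b z‖)
    (hc : ‖c (z + 1) - c z‖ ≤ B * ‖c z‖) :
    maxNorm a b c z * ‖casoratian a b z‖ ≤ 2 * B * ‖(a * b * c) z‖ := by
  have hcz : ∀ z, c z = a z + b z := fun z => (congrFun habc z).symm
  have key : ∀ f g : ℂ → ℂ, ‖f (z + 1) - f z‖ ≤ B * ‖f z‖ → ‖g (z + 1) - g z‖ ≤ B * ‖g z‖ →
      ‖casoratian f g z‖ ≤ 2 * B * (‖f z‖ * ‖g z‖) := fun f g hf hg => by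
    have e : casoratian f g z = f z * (g (z + 1) - g z) - g z * (f (z + 1) - f z) := by
      unfold casoratian; ring
    rw [e]
    refine (norm_sub_le _ _).trans ?_
    rw [norm_mul, norm_mul]
    nlinarith [mul_le_mul_of_nonneg_left hg (norm_nonneg (f z)),
      mul_le_mul_of_nonneg_left hf (norm_nonneg (g z))]
  have e1 : casoratian a b z = casoratian a c z := by
    unfold casoratian; rw [hcz, hcz]; ring
  have e2 : casoratian a b z = casoratian c b z := by
    unfold casoratian; rw [hcz, hcz]; ring
  have h1 := key a b ha hb
  have h2 := key a c ha hc
  have h3 := key c b hc hb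
  rw [← e1] at h2
  rw [← e2] at h3
  simp only [Pi.mul_apply, norm_mul]
  have hm : maxNorm a b c z = ‖a z‖ ∨ maxNorm a b c z = ‖b z‖ ∨ maxNorm a b c z = ‖c z‖ := by
    unfold maxNorm
    rcases max_choice (max ‖a z‖ ‖b z‖) ‖c z‖ with h | h <;> rw [h]
    · rcases max_choice ‖a z‖ ‖b z‖ with h | h <;> rw [h] <;> simp
    · simp
  rcases hm with h | h | h <;> rw [h]
  · nlinarith [mul_le_mul_of_nonneg_left h3 (norm_nonneg (a z))]
  · nlinarith [mul_le_mul_of_nonneg_left h2 (norm_nonneg (b z))]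
  · nlinarith [mul_le_mul_of_nonneg_left h1 (norm_nonneg (c z))]

theorem norm_le_maxNorm (a b c : ℂ → ℂ) (z : ℂ) : ‖a z‖ ≤ maxNorm a b c z :=
  (le_max_left _ _).trans (le_max_left _ _)

theorem circleAverage_log_maxNorm_add_le {a b c : ℂ → ℂ}
    (ha : Differentiable ℂ a) (hb : Differentiable ℂ b) (hc : Differentiable ℂ c)
    (habc : a + b = c) {r B : ℝ} (hr : 0 < r) (hB : 0 < B)
    (ha1 : ∀ z, ‖z‖ = r → a z ≠ 0 ∧ ‖a (z + 1) - a z‖ ≤ B * ‖a z‖)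
    (hb1 : ∀ z, ‖z‖ = r → b z ≠ 0 ∧ ‖b (z + 1) - b z‖ ≤ B * ‖b z‖)
    (hc1 : ∀ z, ‖z‖ = r → c z ≠ 0 ∧ ‖c (z + 1) - c z‖ ≤ B * ‖c z‖)
    (hW : ∀ z, ‖z‖ = r → casoratian a b z ≠ 0) :
    circleAverage (fun z => Real.log (maxNorm a b c z)) 0 r +
      circleAverage (fun z => Real.log ‖casoratian a b z‖) 0 r ≤
      circleAverage (fun z => Real.log ‖(a * b * c) z‖) 0 r + Real.log (2 * B) := by
  have hs : ∀ z ∈ sphere (0 : ℂ) |r|, ‖z‖ = r := fun z hz => by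
    rwa [abs_of_pos hr, mem_sphere_zero_iff_norm] at hz
  have hpos : ∀ z, ‖z‖ = r → 0 < maxNorm a b c z := fun z hz =>
    (norm_pos_iff.2 (ha1 z hz).1).trans_le (norm_le_maxNorm a b c z)
  have hu : Continuous (maxNorm a b c) :=
    (ha.continuous.norm.max hb.continuous.norm).max hc.continuous.norm
  have i1 : CircleIntegrable (fun z => Real.log (maxNorm a b c z)) 0 r :=
    (hu.continuousOn.log fun z hz => (hpos z (hs z hz)).ne').circleIntegrable'
  have hcas := differentiable_casoratian ha hb
  have hmul := (ha.mul hb).mul hc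
  have i2 : CircleIntegrable (fun z => Real.log ‖casoratian a b z‖) 0 r :=
    MeromorphicOn.circleIntegrable_log_norm fun z _ => (hcas.analyticAt z).meromorphicAt
  have i3 : CircleIntegrable (fun z => Real.log ‖(a * b * c) z‖) 0 r :=
    MeromorphicOn.circleIntegrable_log_norm fun z _ => (hmul.analyticAt z).meromorphicAt
  have i4 : CircleIntegrable (fun _ : ℂ => Real.log (2 * B)) 0 r := circleIntegrable_const _ _ _
  rw [← circleAverage_fun_add i1 i2, ← circleAverage_const (Real.log (2 * B)) 0 r,
    ← circleAverage_fun_add i3 i4]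
  refine circleAverage_mono (i1.add i2) (i3.add i4) fun z hz => ?_
  have hz := hs z hz
  have h1 := maxNorm_mul_norm_casoratian_le habc (ha1 z hz).2 (hb1 z hz).2 (hc1 z hz).2
  have hWz := norm_pos_iff.2 (hW z hz)
  have hz3 : 0 < ‖(a * b * c) z‖ :=
    norm_pos_iff.2 (mul_ne_zero (mul_ne_zero (ha1 z hz).1 (hb1 z hz).1) (hc1 z hz).1)
  have h2 := Real.log_le_log (mul_pos (hpos z hz) hWz) h1
  rw [Real.log_mul (hpos z hz).ne' hWz.ne', Real.log_mul (by positivity) hz3.ne'] at h2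
  linarith

theorem FiniteLogMeasure.union {E F : Set ℝ} (hE : FiniteLogMeasure E) (hF : FiniteLogMeasure F) :
    FiniteLogMeasure (E ∪ F) :=
  ⟨union_subset hE.1 hF.1, hE.2.1.union hF.2.1,
    (lintegral_union_le _ _ _).trans_lt (ENNReal.add_lt_top.2 ⟨hE.2.2, hF.2.2⟩)⟩

theorem finiteLogMeasure_Ioc (R : ℝ) : FiniteLogMeasure (Ioc 1 R) := by
  refine ⟨fun x hx => hx.1, measurableSet_Ioc, setLIntegral_lt_top_of_le (g := fun _ => 1)
    measurableSet_Ioc (by simp) fun x hx => ?_⟩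
  exact ENNReal.ofReal_le_ofReal (inv_le_one_of_one_le₀ hx.1.le)

theorem finiteLogMeasure_of_countable {E : Set ℝ} (hE : E.Countable) (h1 : E ⊆ Ioi 1) :
    FiniteLogMeasure E :=
  ⟨h1, hE.measurableSet, by simp [Measure.restrict_eq_zero.2 (hE.measure_zero volume)]⟩

/-- An inequality that holds for large `r` outside a set of finite logarithmic measure holds for
`r > 1` outside such a set. -/
theorem exists_finiteLogMeasure_of_eventually {p : ℝ → Prop} {E : Set ℝ} (hE : FiniteLogMeasure E)
    (h : ∀ᶠ r in atTop, r ∉ E → p r) :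
    ∃ E', FiniteLogMeasure E' ∧ ∀ r, 1 < r → r ∉ E' → p r := by
  obtain ⟨R, hR⟩ := eventually_atTop.1 h
  refine ⟨E ∪ Ioc 1 R, hE.union (finiteLogMeasure_Ioc R), fun r hr hrE => ?_⟩
  simp only [mem_union, mem_Ioc, not_or, not_and, not_le] at hrE
  exact hR r (hrE.2 hr).le hrE.1

theorem cartanChar_le_of_casoratian_ne_zero {a b c : ℂ → ℂ}
    (ha : Differentiable ℂ a) (hb : Differentiable ℂ b) (hc : Differentiable ℂ c)
    (ha0 : a ≠ 0) (hb0 : b ≠ 0) (hc0 : c ≠ 0)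
    (hρa : growthOrder a < 1) (hρb : growthOrder b < 1) (hρc : growthOrder c < 1)
    (hab : RelativelyShiftingPrime a b) (hac : RelativelyShiftingPrime a c)
    (hbc : RelativelyShiftingPrime b c) (habc : a + b = c) (hW0 : casoratian a b ≠ 0)
    {δ : ℝ} (hδ : (δ : EReal) = max (max (growthOrder a) (growthOrder b)) (growthOrder c))
    {ε : ℝ} (hε : 0 < ε) :
    ∃ E : Set ℝ, FiniteLogMeasure E ∧ ∀ r : ℝ, 1 < r → r ∉ E →
      cartanChar a b c r ≤ NBarDelta r (a * b * c) - (1 - δ - ε) * Real.log r := by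
  have hδ1 : δ < 1 := by
    have : (δ : EReal) < 1 := by rw [hδ]; exact max_lt (max_lt hρa hρb) hρc
    exact_mod_cast this
  -- γ > δ is needed for the difference estimate; γ < δ + ε leaves a multiple of log r that absorbs
  -- all constants.
  obtain ⟨γ, hγ, hγ'⟩ := exists_between (lt_min (by linarith : δ < δ + ε) hδ1)
  have hγ1 : γ < 1 := hγ'.trans_le (min_le_right _ _)
  have hγε : γ < δ + ε := hγ'.trans_le (min_le_left _ _)
  have hδγ : (δ : EReal) < γ := by exact_mod_cast hγ
  rw [hδ] at hδγ
  have hmax := max_lt_iff.1 hδγ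
  obtain ⟨Ea, hEa, hEa'⟩ := exists_exceptional_set ha ha0 (max_lt_iff.1 hmax.1).1 hγ1
  obtain ⟨Eb, hEb, hEb'⟩ := exists_exceptional_set hb hb0 (max_lt_iff.1 hmax.1).2 hγ1
  obtain ⟨Ec, hEc, hEc'⟩ := exists_exceptional_set hc hc0 hmax.2 hγ1
  have hW := differentiable_casoratian ha hb
  set W := casoratian a b
  -- Radii of circles through a zero of W are excluded too, so that log|W| is a genuine logarithm on
  -- the circle.
  have hEW : FiniteLogMeasure (norm '' {w | W w = 0} ∩ Ioi 1) :=
    finiteLogMeasure_of_countable (((countable_zeros hW hW0).image _).mono inter_subset_left)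
      inter_subset_right
  refine exists_finiteLogMeasure_of_eventually (((hEa.union hEb).union hEc).union hEW) ?_
  set κ := if maxNorm a b c 0 ≠ 0 then Real.log (maxNorm a b c 0)
    else max (max (Real.log ‖meromorphicTrailingCoeffAt a 0‖)
      (Real.log ‖meromorphicTrailingCoeffAt b 0‖)) (Real.log ‖meromorphicTrailingCoeffAt c 0‖)
    with hκ
  set C := Real.log ‖meromorphicTrailingCoeffAt (a * b * c) 0‖ -
    Real.log ‖meromorphicTrailingCoeffAt W 0‖ + Real.log 4 - κ
  filter_upwards [eventually_gt_atTop 1, (tendsto_log_atTop.const_mul_atTop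
    (by linarith : 0 < δ + ε - γ)).eventually (eventually_ge_atTop C)] with r hr hrC hrE
  simp only [mem_union, not_or] at hrE
  obtain ⟨⟨⟨h1, h2⟩, h3⟩, h4⟩ := hrE
  have hr0 : 0 < r := by linarith
  have hWz : ∀ z, ‖z‖ = r → W z ≠ 0 := fun z hz hz0 => h4 ⟨⟨z, hz0, hz⟩, hr⟩
  have key := circleAverage_log_maxNorm_add_le ha hb hc habc (B := 2 * r ^ (γ - 1)) hr0
    (by positivity) (fun z hz => by rw [← hz] at hr h1 ⊢; exact hEa' z hr h1)
    (fun z hz => by rw [← hz] at hr h2 ⊢; exact hEb' z hr h2)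
    (fun z hz => by rw [← hz] at hr h3 ⊢; exact hEc' z hr h3) hWz
  have hN := le_NBarDelta_add ((ha.mul hb).mul hc)
    (entire_mul_ne_zero (ha.mul hb) hc (entire_mul_ne_zero ha hb ha0 hb0) hc0) hW hW0
    (min_orderNat_mul_mul_le ha hb hc ha0 hb0 hc0 hρa hρb hρc hab hac hbc habc hW0) hr.le
  rw [show 2 * (2 * r ^ (γ - 1)) = 4 * r ^ (γ - 1) by ring,
    Real.log_mul (by norm_num) (by positivity), Real.log_rpow hr0] at key
  rw [cartanChar, ← hκ]
  have e : (δ + ε - γ) * Real.log r = (γ - 1) * Real.log r * (-1) -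
    (1 - δ - ε) * Real.log r := by ring
  simp only [C] at hrC
  linarith

/-! ### The case of proportional functions -/

/-- If zeros of `f` are never followed by zeros of `f`, then `NBarDelta` counts all zeros. -/
theorem NBarDelta_eq_circleAverage {f : ℂ → ℂ} (hf : Differentiable ℂ f) (h0 : f ≠ 0)
    (h : ∀ z, f z = 0 → f (z + 1) ≠ 0) {R : ℝ} (hR : 0 < R) :
    NBarDelta R f = circleAverage (fun z => Real.log ‖f z‖) 0 R -
      Real.log ‖meromorphicTrailingCoeffAt f 0‖ := by
  rw [NBarDelta_eq hf h0 (S := zeroFinset f R)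
    (fun w h1 h2 => (mem_zeroFinset hf h0).2 ⟨h1, h2⟩) hR, circleAverage_log_norm_eq hf h0 hR,
    add_sub_cancel_right]
  have hμ : ∀ w, min (analyticOrderNatAt f w) (analyticOrderNatAt f (w - 1)) = 0 := fun w => by
    by_cases hw : f (w - 1) = 0
    · have := h _ hw
      rw [sub_add_cancel] at this
      rw [(orderNat_eq_zero_iff hf h0 w).2 this, Nat.zero_min]
    · rw [(orderNat_eq_zero_iff hf h0 _).2 hw, Nat.min_zero]
  simp only [hμ, Nat.cast_zero, zero_mul, Finset.sum_const_zero, sub_zero]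
  exact Finset.sum_congr rfl fun w hw => by
    rw [logWeight_of_le ((mem_zeroFinset hf h0).1 hw).1]

theorem log_sub_log_norm_le_circleAverage {f : ℂ → ℂ} (hf : Differentiable ℂ f) (h0 : f ≠ 0)
    {w : ℂ} (hw : f w = 0) {R : ℝ} (hR : 1 ≤ R) (hwR : ‖w‖ ≤ R) :
    Real.log R - Real.log ‖w‖ ≤ circleAverage (fun z => Real.log ‖f z‖) 0 R -
      Real.log ‖meromorphicTrailingCoeffAt f 0‖ := by
  rw [circleAverage_log_norm_eq hf h0 (by linarith), add_sub_cancel_right]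
  have hnn : ∀ v ∈ zeroFinset f R, 0 ≤ Real.log R - Real.log ‖v‖ := fun v hv =>
    sub_nonneg.2 (log_le_log_of_nonneg_of_one_le (norm_nonneg v) hR
      ((mem_zeroFinset hf h0).1 hv).1)
  have hmem : w ∈ zeroFinset f R := (mem_zeroFinset hf h0).2 ⟨hwR, hw⟩
  refine le_trans ?_ (Finset.single_le_sum
    (f := fun v => (analyticOrderNatAt f v : ℝ) * (Real.log R - Real.log ‖v‖))
    (fun v hv => mul_nonneg (by positivity) (hnn v hv)) hmem)
  exact le_mul_of_one_le_left (hnn w hmem) (by exact_mod_cast orderNat_pos hf h0 hw)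

theorem orderNat_smul {f : ℂ → ℂ} (hf : Differentiable ℂ f) (h0 : f ≠ 0) {k : ℂ} (hk : k ≠ 0)
    (w : ℂ) : analyticOrderNatAt (k • f) w = analyticOrderNatAt f w := by
  have hc0 : (fun _ : ℂ => k) ≠ 0 := fun h => hk (congrFun h 0)
  have e : k • f = (fun _ => k) * f := rfl
  rw [e, orderNat_mul (differentiable_const k) hf hc0 h0,
    (orderNat_eq_zero_iff (differentiable_const k) hc0 w).2 hk, zero_add]

theorem NBarDelta_smul {f : ℂ → ℂ} (hf : Differentiable ℂ f) (h0 : f ≠ 0) {k : ℂ} (hk : k ≠ 0)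
    {R : ℝ} (hR : 0 < R) : NBarDelta R (k • f) = NBarDelta R f := by
  have hkf : k • f ≠ 0 := smul_ne_zero hk h0
  rw [NBarDelta_eq hf h0 (S := zeroFinset f R)
      (fun w h1 h2 => (mem_zeroFinset hf h0).2 ⟨h1, h2⟩) hR,
    NBarDelta_eq (hf.const_smul k) hkf (S := zeroFinset f R)
      (fun w h1 h2 => (mem_zeroFinset hf h0).2 ⟨h1, by simpa [hk] using h2⟩) hR]
  simp only [orderNat_smul hf h0 hk]

/-- Here u is a constant multiple of |a|, so the left side is N(r, 1/a) + O(1), against 3 N(r, 1/a)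
on the right. One zero w gives 2 N(r, 1/a) ≥ 2 log r - 2 log|w|, which exceeds (1-δ-ε) log r by at
least log r. -/
theorem cartanChar_le_of_proportional {a b c : ℂ → ℂ}
    (ha : Differentiable ℂ a) (ha0 : a ≠ 0) (hρa : growthOrder a < 1)
    (hab : RelativelyShiftingPrime a b) {k l : ℂ} (hk : k ≠ 0) (hl : l ≠ 0)
    (hbk : b = k • a) (hcl : c = l • a) (hρb : growthOrder b < 1)
    (hconst : ¬ ∃ k, ∀ z, a z = k) {δ ε : ℝ} (hδ : 0 ≤ δ) (hε : 0 < ε) :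
    ∃ E : Set ℝ, FiniteLogMeasure E ∧ ∀ r : ℝ, 1 < r → r ∉ E →
      cartanChar a b c r ≤ NBarDelta r a + NBarDelta r b + NBarDelta r c -
        (1 - δ - ε) * Real.log r := by
  have hb : Differentiable ℂ b := hbk ▸ ha.const_smul k
  have hb0 : b ≠ 0 := hbk ▸ smul_ne_zero hk ha0
  obtain ⟨w, hw⟩ := exists_zero_of_not_constant ha hρa hconst
  have hne : ∀ z, a z = 0 → a (z + 1) ≠ 0 := fun z hz h => by
    refine hab.ne_zero ha hb ha0 hb0 hρa hρb hz ?_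
    simp [hbk, h]
  set M := max (max 1 ‖k‖) ‖l‖ with hM
  have hM1 : 1 ≤ M := (le_max_left _ _).trans (le_max_left _ _)
  have hu : ∀ z, maxNorm a b c z = M * ‖a z‖ := fun z => by
    simp only [maxNorm, hbk, hcl, Pi.smul_apply, smul_eq_mul, norm_mul, hM,
      max_mul_of_nonneg _ _ (norm_nonneg (a z)), one_mul]
  have hE : FiniteLogMeasure (norm '' {w | a w = 0} ∩ Ioi 1) :=
    finiteLogMeasure_of_countable (((countable_zeros ha ha0).image _).mono inter_subset_left)
      inter_subset_right
  refine exists_finiteLogMeasure_of_eventually hE ?_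
  set κ := if maxNorm a b c 0 ≠ 0 then Real.log (maxNorm a b c 0)
    else max (max (Real.log ‖meromorphicTrailingCoeffAt a 0‖)
      (Real.log ‖meromorphicTrailingCoeffAt b 0‖)) (Real.log ‖meromorphicTrailingCoeffAt c 0‖)
    with hκ
  set q := Real.log ‖meromorphicTrailingCoeffAt a 0‖
  -- The threshold collects the constants of both sides, to be absorbed by the spare log r.
  filter_upwards [eventually_gt_atTop 1, eventually_ge_atTop ‖w‖,
    tendsto_log_atTop.eventually (eventually_ge_atTop (Real.log M + q - κ + 2 * Real.log ‖w‖))]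
    with r hr hrw hrC hrE
  have hr0 : 0 < r := by linarith
  have havg : circleAverage (fun z => Real.log (maxNorm a b c z)) 0 r =
      Real.log M + circleAverage (fun z => Real.log ‖a z‖) 0 r := by
    have i2 : CircleIntegrable (fun z => Real.log ‖a z‖) 0 r :=
      MeromorphicOn.circleIntegrable_log_norm fun z _ => (ha.analyticAt z).meromorphicAt
    rw [← circleAverage_const (Real.log M) 0 r,
      ← circleAverage_fun_add (circleIntegrable_const _ _ _) i2]
    refine circleAverage_congr_sphere fun z hz => ?_
    rw [abs_of_pos hr0, mem_sphere_zero_iff_norm] at hz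
    have hz0 : a z ≠ 0 := fun h => hrE ⟨⟨z, h, hz⟩, hr⟩
    simp only [hu]
    exact Real.log_mul (by linarith) (norm_ne_zero_iff.2 hz0)
  have h1 := NBarDelta_eq_circleAverage ha ha0 hne hr0
  have h2 := log_sub_log_norm_le_circleAverage ha ha0 hw hr.le hrw
  rw [cartanChar, ← hκ, hbk, hcl, NBarDelta_smul ha ha0 hk hr0, NBarDelta_smul ha ha0 hl hr0,
    ← hbk, ← hcl, havg, h1]
  have hlog := Real.log_pos hr
  nlinarith

end DiffABC

/-! ### The theorem -/

theorem theorem3p1 (a b c : ℂ → ℂ)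
    (ha : Differentiable ℂ a) (hb : Differentiable ℂ b) (hc : Differentiable ℂ c)
    (ha0 : a ≠ 0) (hb0 : b ≠ 0) (hc0 : c ≠ 0)
    (hρa : growthOrder a < 1) (hρb : growthOrder b < 1) (hρc : growthOrder c < 1)
    (hab : RelativelyShiftingPrime a b) (hac : RelativelyShiftingPrime a c)
    (hbc : RelativelyShiftingPrime b c)
    (habc : a + b = c)
    (hconst : ¬ ((∃ k, ∀ z, a z = k) ∧ (∃ k, ∀ z, b z = k) ∧ (∃ k, ∀ z, c z = k)))
    (δ : ℝ)
    (hδ : (δ : EReal) = max (max (growthOrder a) (growthOrder b)) (growthOrder c)) :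
    ∃ R : ℝ, 0 < R ∧ ∀ ε : ℝ, 0 < ε →
      ∃ E : Set ℝ, FiniteLogMeasure E ∧ ∀ r : ℝ, R < r → r ∉ E →
        cartanChar a b c r ≤ NBarDelta r (a * b * c) - (1 - δ - ε) * Real.log r ∧
        NBarDelta r (a * b * c) = NBarDelta r a + NBarDelta r b + NBarDelta r c := by
  have hadd : ∀ r : ℝ, 1 < r →
      NBarDelta r (a * b * c) = NBarDelta r a + NBarDelta r b + NBarDelta r c := fun r hr =>
    NBarDelta_mul_mul ha hb hc ha0 hb0 hc0 hρa hρb hρc hab hac hbc (by linarith)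
  -- R = 1 serves every ε, since the bounded range of radii depending on ε is put into the
  -- exceptional set.
  refine ⟨1, one_pos, fun ε hε => ?_⟩
  by_cases hW : casoratian a b = 0
  · obtain ⟨k, hk, hbk⟩ := casoratian_eq_zero_proportional ha hb ha0 hb0 hρa hρb hab hW
    have hcl : c = (1 + k) • a := by rw [← habc, hbk, add_smul, one_smul]
    have hl : 1 + k ≠ 0 := fun h => hc0 (by rw [hcl, h, zero_smul])
    have hδ0 : 0 ≤ δ := by
      have : (0 : EReal) ≤ δ := by
        rw [hδ]
        exact (growthOrder_nonneg c).trans (le_max_right _ _)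
      exact_mod_cast this
    -- The assumption that a, b, c are not all constant matters only here: it provides a zero of a
    -- when b and c are multiples of a.
    have hca : ¬ ∃ k, ∀ z, a z = k := by
      rintro ⟨q, hq⟩
      exact hconst ⟨⟨q, hq⟩, ⟨k * q, fun z => by simp [hbk, hq]⟩,
        ⟨(1 + k) * q, fun z => by simp [hcl, hq]⟩⟩
    obtain ⟨E, hE, h⟩ := cartanChar_le_of_proportional ha ha0 hρa hab hk hl hbk hcl hρb hca hδ0 hε
    exact ⟨E, hE, fun r hr hrE => ⟨by rw [hadd r hr]; exact h r hr hrE, hadd r hr⟩⟩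
  · obtain ⟨E, hE, h⟩ := cartanChar_le_of_casoratian_ne_zero ha hb hc ha0 hb0 hc0 hρa hρb hρc
      hab hac hbc habc hW hδ hε
    exact ⟨E, hE, fun r hr hrE => ⟨h r hr hrE, hadd r hr⟩⟩
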